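/- A \emph{contextuality scenario} is a pair $\mathbb{G}=(V,E)$, where $V$ is a finite set and $E$ is a non-empty set of subsets of $V$ with $\bigcup_{e\in E}e=V$. A \emph{probabilistic model} of $\mathbb{G}$ is a function $p:V\to[0,1]$ with $\sum_{x\in e}p(x)=1$ for all $e\in E$; $\mathbb{G}$ is \emph{non-trivial} if it admits a probabilistic model. A \emph{positive operator representation} (POR) of $\mathbb{G}$ on a Hilbert space $\mathcal{H}$ is a family $(A_x)_{x\in V}$ of positive operators in $\mathcal{B}(\mathcal{H})$ with $\sum_{x\in e}A_x=I_{\mathcal{H}}$ for all $e\in E$. For $e\in E$ let $\ell^\infty_e$ be the space of complex functions on $e$, with canonical basis $(\delta^e_x)_{x\in e}$, and let $\mathcal{S}=\bigoplus_{e\in E}\ell^\infty_e$, with embeddings $\iota_e:\ell^\infty_e\to\mathcal{S}$; these are operator systems in the canonical way. Let $\tilde{\mathcal{J}}$ be the space of all $u=\oplus_{e}(u^e_x)_{x\in e}\in\mathcal{S}$ with $\sum_{e\in E}\sum_{x\in e}p(x)u^e_x=0$ for every probabilistic model $p$ of $\mathbb{G}$; it is an intersection of kernels of states. Let $\mathcal{S}_{\mathbb{G}}=\mathcal{S}/\tilde{\mathcal{J}}$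 be the operator system quotient with quotient map $q$: a matrix $Y\in M_n(\mathcal{S}_{\mathbb{G}})$ is positive if and only if for every $\varepsilon>0$ there is $X\in M_n(\mathcal{S})$ with $q^{(n)}(X)=Y$ and $\varepsilon 1+X\in M_n(\mathcal{S})^+$, and the unit is $q(1)$. Set $i_e=|E|\,(q\circ\iota_e):\ell^\infty_e\to\mathcal{S}_{\mathbb{G}}$ and $a_x=i_e(\delta^e_x)$ for $x\in e$, which does not depend on the choice of $e$. \textbf{Theorem.} Let $\mathbb{G}=(V,E)$ be a non-trivial contextuality scenario. (1) Let $\mathcal{H}$ be a Hilbert space. If $\Phi:\mathcal{S}_{\mathbb{G}}\to\mathcal{B}(\mathcal{H})$ is a unital completely positive map, then $(\Phi(a_x))_{x\in V}$ is a POR of $\mathbb{G}$. Conversely, if $(A_x)_{x\in V}\subseteq\mathcal{B}(\mathcal{H})$ is a POR of $\mathbb{G}$, then there exists a unique unital completely positive map $\Phi:\mathcal{S}_{\mathbb{G}}\to\mathcal{B}(\mathcal{H})$ such that $\Phi(a_x)=A_x$ for all $x\in V$. (2) The maps $i_e$, $e\in E$, are unital and completely positive. Suppose that $\mathcal{R}$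 is an (abstract) operator system and $r_e:\ell^\infty_e\to\mathcal{R}$, $e\in E$, are unital completely positive maps such that $r_e(\delta^e_x)=r_f(\delta^f_x)$ whenever $e,f\in E$ and $x\in e\cap f$, with the property that for every POR $(A_x)_{x\in V}$ of $\mathbb{G}$ on a Hilbert space $\mathcal{H}$ there exists a unique unital completely positive map $\Psi:\mathcal{R}\to\mathcal{B}(\mathcal{H})$ with $\Psi(r_e(\delta^e_x))=A_x$ for all $e\in E$ and $x\in e$. Then there exists a unital complete order isomorphism $\theta:\mathcal{R}\to\mathcal{S}_{\mathbb{G}}$ such that $\theta\circ r_e=i_e$ for all $e\in E$. -/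

import Mathlib

open scoped ComplexOrder

/-! ### Abstract operator systems -/

/-- The compression `T* X T` of a matrix `X` over a complex vector space by a scalar matrix `T`. -/
def matCompress {S : Type*} [AddCommGroup S] [Module ℂ S] {n m : ℕ}
    (T : Matrix (Fin n) (Fin m) ℂ) (X : Matrix (Fin n) (Fin n) S) :
    Matrix (Fin m) (Fin m) S :=
  Matrix.of fun i j => ∑ k, ∑ l, (star (T k i) * T l j) • X k l

lemma matCompress_add {S : Type*} [AddCommGroup S] [Module ℂ S] {n m : ℕ}
    (T : Matrix (Fin n) (Fin m) ℂ) (X Y : Matrix (Fin n) (Fin n) S) :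
    matCompress T (X + Y) = matCompress T X + matCompress T Y := by
  ext i j
  simp [matCompress, Finset.sum_add_distrib]

lemma matCompress_smul {S : Type*} [AddCommGroup S] [Module ℂ S] {n m : ℕ}
    (T : Matrix (Fin n) (Fin m) ℂ) (c : ℂ) (X : Matrix (Fin n) (Fin n) S) : matCompress T (c • X) = c • matCompress T X := by
  ext i j
  simp only [matCompress, Matrix.smul_apply, Matrix.of_apply, Finset.smul_sum]
  exact Finset.sum_congr rfl fun k _ => Finset.sum_congr rfl fun l _ => smul_comm _ _ _

/-- An (abstract) operator system structure on a complex `*`-vector space `S`: a matrix ordering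
by proper cones `M_n(S)⁺ ⊆ M_n(S)_h`, with an Archimedean matrix order unit. -/
class OperatorSystem (S : Type*) [AddCommGroup S] [Module ℂ S] [StarAddMonoid S]
    [StarModule ℂ S] where
  /-- the unit -/
  unit : S
  /-- the cone `M_n(S)⁺` -/
  cone : (n : ℕ) → Set (Matrix (Fin n) (Fin n) S)
  isHermitian_of_mem : ∀ {n : ℕ} {X : Matrix (Fin n) (Fin n) S}, X ∈ cone n → X.IsHermitian
  zero_mem : ∀ n : ℕ, (0 : Matrix (Fin n) (Fin n) S) ∈ cone n
  add_mem : ∀ {n : ℕ} {X Y : Matrix (Fin n) (Fin n) S},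
    X ∈ cone n → Y ∈ cone n → X + Y ∈ cone n
  smul_mem : ∀ {n : ℕ} {r : ℝ} {X : Matrix (Fin n) (Fin n) S},
    0 ≤ r → X ∈ cone n → (r : ℂ) • X ∈ cone n
  proper : ∀ {n : ℕ} {X : Matrix (Fin n) (Fin n) S}, X ∈ cone n → -X ∈ cone n → X = 0
  compress_mem : ∀ {n m : ℕ} (T : Matrix (Fin n) (Fin m) ℂ) {X : Matrix (Fin n) (Fin n) S},
    X ∈ cone n → matCompress T X ∈ cone m
  isHermitian_unit : star unit = unit
  order_unit : ∀ {n : ℕ} (X : Matrix (Fin n) (Fin n) S), X.IsHermitian →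
    ∃ r : ℝ, 0 < r ∧ (r : ℂ) • Matrix.diagonal (fun _ : Fin n => unit) - X ∈ cone n
  archimedean : ∀ {n : ℕ} (X : Matrix (Fin n) (Fin n) S),
    (∀ r : ℝ, 0 < r → (r : ℂ) • Matrix.diagonal (fun _ : Fin n => unit) + X ∈ cone n) →
      X ∈ cone n

namespace OperatorSystem

/-- The unit `1 ⊗ I_n` of `M_n(S)`. -/
def matUnit (S : Type*) [AddCommGroup S] [Module ℂ S] [StarAddMonoid S] [StarModule ℂ S]
    [OperatorSystem S] (n : ℕ) : Matrix (Fin n) (Fin n) S :=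
  Matrix.diagonal (fun _ => unit)

section maps

variable {S T : Type*} [AddCommGroup S] [Module ℂ S] [StarAddMonoid S] [StarModule ℂ S]
  [OperatorSystem S] [AddCommGroup T] [Module ℂ T] [StarAddMonoid T] [StarModule ℂ T]
  [OperatorSystem T]

/-- A linear map is completely positive if all its amplifications (entrywise application to
`n × n` matrices) are positive. -/
def IsCP (φ : S →ₗ[ℂ] T) : Prop :=
  ∀ (n : ℕ) (X : Matrix (Fin n) (Fin n) S), X ∈ cone n → X.map φ ∈ (cone n : Set (Matrix _ _ T))

/-- Unital completely positive maps. -/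
def IsUCP (φ : S →ₗ[ℂ] T) : Prop :=
  φ unit = unit ∧ IsCP φ

/-- Unital complete order isomorphisms. -/
def IsUnitalCompleteOrderIso (φ : S ≃ₗ[ℂ] T) : Prop :=
  IsUCP (φ : S →ₗ[ℂ] T) ∧ IsCP (φ.symm : T →ₗ[ℂ] S)

/-- States: unital positive linear functionals. -/
def IsState (f : S →ₗ[ℂ] ℂ) : Prop :=
  f unit = 1 ∧ ∀ x : S, Matrix.of (fun _ _ : Fin 1 => x) ∈ cone 1 → 0 ≤ f x

end maps

/-! ### Scalar matrices: auxiliary facts -/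

lemma quad_bound {H : Type*} [NormedAddCommGroup H] [InnerProductSpace ℂ H] {n : ℕ}
    (X : Matrix (Fin n) (Fin n) (H →L[ℂ] H)) (ξ : Fin n → H) :
    ‖∑ i, ∑ j, inner ℂ (ξ i) (X i j (ξ j))‖ ≤ (∑ i, ∑ j, ‖X i j‖) * ∑ k, ‖ξ k‖ ^ 2 := by
  have key : ∀ i j, ‖inner ℂ (ξ i) (X i j (ξ j))‖ ≤ ‖X i j‖ * ∑ k, ‖ξ k‖ ^ 2 := by
    intro i j
    have h1 : ‖inner ℂ (ξ i) (X i j (ξ j))‖ ≤ ‖ξ i‖ * (‖X i j‖ * ‖ξ j‖) :=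
      (norm_inner_le_norm _ _).trans
        (mul_le_mul_of_nonneg_left ((X i j).le_opNorm _) (norm_nonneg _))
    have hi : ‖ξ i‖ ^ 2 ≤ ∑ k, ‖ξ k‖ ^ 2 :=
      Finset.single_le_sum (f := fun k => ‖ξ k‖ ^ 2) (fun _ _ => by positivity)
        (Finset.mem_univ i)
    have hj : ‖ξ j‖ ^ 2 ≤ ∑ k, ‖ξ k‖ ^ 2 :=
      Finset.single_le_sum (f := fun k => ‖ξ k‖ ^ 2) (fun _ _ => by positivity)
        (Finset.mem_univ j)
    have h2 : ‖ξ i‖ * ‖ξ j‖ ≤ ∑ k, ‖ξ k‖ ^ 2 := by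
      nlinarith [sq_nonneg (‖ξ i‖ - ‖ξ j‖)]
    calc _ ≤ ‖X i j‖ * (‖ξ i‖ * ‖ξ j‖) := by linarith
      _ ≤ _ := mul_le_mul_of_nonneg_left h2 (norm_nonneg _)
  calc _ ≤ ∑ i, ∑ j, ‖inner ℂ (ξ i) (X i j (ξ j))‖ :=
        (norm_sum_le _ _).trans (Finset.sum_le_sum fun i _ => norm_sum_le _ _)
    _ ≤ ∑ i, ∑ j, ‖X i j‖ * ∑ k, ‖ξ k‖ ^ 2 :=
        Finset.sum_le_sum fun i _ => Finset.sum_le_sum fun j _ => key i j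
    _ = _ := by simp_rw [← Finset.sum_mul]

lemma nonneg_of_forall_eps {z : ℂ} {c : ℝ} (hc : 0 ≤ c)
    (h : ∀ r : ℝ, 0 < r → 0 ≤ (r : ℂ) * (c : ℂ) + z) : 0 ≤ z := by
  have him : z.im = 0 := by
    have := (Complex.nonneg_iff.1 (h 1 one_pos)).2
    simpa using this.symm
  refine Complex.nonneg_iff.2 ⟨?_, him.symm⟩
  by_contra hz
  push Not at hz
  have h1 := (Complex.nonneg_iff.1 (h (-z.re / (2 * (c + 1))) (by
    apply div_pos <;> linarith))).1
  rw [← Complex.ofReal_mul, Complex.add_re, Complex.ofReal_re] at h1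
  have : -z.re / (2 * (c + 1)) * c ≤ -z.re / 2 := by
    rw [div_mul_eq_mul_div, div_le_div_iff₀ (by linarith) (by norm_num)]
    nlinarith
  linarith

lemma eq_zero_of_nonneg_of_neg_nonneg {z : ℂ} (h : 0 ≤ z) (h' : 0 ≤ -z) : z = 0 :=
  le_antisymm (neg_nonneg.1 h') h

/-! ### The operator system `B(H)` -/

section BH

variable {H : Type*} [NormedAddCommGroup H] [InnerProductSpace ℂ H]

lemma quad_add_smul {n : ℕ} (X : Matrix (Fin n) (Fin n) (H →L[ℂ] H)) (r : ℂ) (ξ : Fin n → H) :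
    ∑ i, ∑ j, inner ℂ (ξ i)
      ((r • Matrix.diagonal (fun _ : Fin n => (1 : H →L[ℂ] H)) + X) i j (ξ j)) =
    r * ((∑ k, ‖ξ k‖ ^ 2 : ℝ) : ℂ) + ∑ i, ∑ j, inner ℂ (ξ i) (X i j (ξ j)) := by
  have : ∀ i j, inner ℂ (ξ i)
      ((r • Matrix.diagonal (fun _ : Fin n => (1 : H →L[ℂ] H)) + X) i j (ξ j)) =
      (if i = j then r * ((‖ξ i‖ ^ 2 : ℝ) : ℂ) else 0) + inner ℂ (ξ i) (X i j (ξ j)) := by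
    intro i j
    by_cases hij : i = j
    · subst hij
      simp [inner_self_eq_norm_sq_to_K]
    · simp [hij]
  simp_rw [this, Finset.sum_add_distrib]
  congr 1
  simp [Finset.mul_sum]

variable [CompleteSpace H]

lemma quad_im_zero {n : ℕ} {X : Matrix (Fin n) (Fin n) (H →L[ℂ] H)} (hX : X.IsHermitian)
    (ξ : Fin n → H) : (∑ i, ∑ j, inner ℂ (ξ i) (X i j (ξ j))).im = 0 := by
  rw [← Complex.conj_eq_iff_im, map_sum]
  simp_rw [map_sum, inner_conj_symm]
  rw [Finset.sum_comm]
  refine Finset.sum_congr rfl fun i _ => Finset.sum_congr rfl fun j _ => ?_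
  have : X j i = ContinuousLinearMap.adjoint (X i j) := (hX.apply j i).symm
  rw [this, ContinuousLinearMap.adjoint_inner_left]

/-- `B(H)` as an operator system: `M_n(B(H)) = B(Hⁿ)`, so `X ∈ M_n(B(H))` is positive
iff `⟨X ξ, ξ⟩ ≥ 0` for all `ξ ∈ Hⁿ`. -/
instance instBH : OperatorSystem (H →L[ℂ] H) where
  unit := 1
  cone n := {X | X.IsHermitian ∧ ∀ ξ : Fin n → H, 0 ≤ ∑ i, ∑ j, inner ℂ (ξ i) (X i j (ξ j))}
  isHermitian_of_mem h := h.1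
  zero_mem n := ⟨Matrix.isHermitian_zero, by simp⟩
  add_mem hX hY := ⟨hX.1.add hY.1, fun ξ => by
    have := add_nonneg (hX.2 ξ) (hY.2 ξ)
    simpa [inner_add_right, Finset.sum_add_distrib] using this⟩
  smul_mem {n r X} hr hX := by
    refine ⟨?_, fun ξ => ?_⟩
    · ext1 i j
      have := hX.1.apply i j
      simp [this]
    · have := mul_nonneg (Complex.zero_le_real.2 hr) (hX.2 ξ)
      simpa [inner_smul_right, Finset.mul_sum] using this
  proper {n X} hX hX' := by
    have h0 : ∀ ξ : Fin n → H, ∑ i, ∑ j, inner ℂ (ξ i) (X i j (ξ j)) = 0 := fun ξ =>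
      eq_zero_of_nonneg_of_neg_nonneg (hX.2 ξ) (by simpa using hX'.2 ξ)
    have hexp : ∀ ξ η : Fin n → H, (∑ i, ∑ j, inner ℂ (ξ i) (X i j (η j))) +
        ∑ i, ∑ j, inner ℂ (η i) (X i j (ξ j)) = 0 := by
      intro ξ η
      have h1 := h0 (ξ + η)
      have h2 := h0 ξ
      have h3 := h0 η
      simp only [Pi.add_apply, map_add, inner_add_left, inner_add_right,
        Finset.sum_add_distrib] at h1
      linear_combination h1 - h2 - h3
    have hz : ∀ ξ η : Fin n → H, ∑ i, ∑ j, inner ℂ (ξ i) (X i j (η j)) = 0 := by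
      intro ξ η
      have h1 := hexp ξ η
      have h2 := hexp ξ (Complex.I • η)
      simp only [Pi.smul_apply, map_smul, inner_smul_left, inner_smul_right, Complex.conj_I,
        ← Finset.mul_sum] at h2
      have h3 : Complex.I * (2 * ∑ i, ∑ j, inner ℂ (ξ i) (X i j (η j))) = 0 := by
        linear_combination h2 + Complex.I * h1
      simpa using h3
    ext i j v
    have := hz (Pi.single i (X i j v)) (Pi.single j v)
    rw [Finset.sum_eq_single i, Finset.sum_eq_single j] at this
    · simpa using this
    · intro b _ hb; simp [hb]
    · simp
    · intro b _ hb; simp [hb]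
    · simp
  compress_mem {n m} T {X} hX := by
    refine ⟨?_, fun ξ => ?_⟩
    · ext1 i j
      simp only [Matrix.conjTranspose_apply, matCompress, Matrix.of_apply, star_sum, star_smul]
      rw [Finset.sum_comm]
      refine Finset.sum_congr rfl fun k _ => Finset.sum_congr rfl fun l _ => ?_
      rw [hX.1.apply]
      simp [mul_comm]
    · have := hX.2 (fun k => ∑ i, T k i • ξ i)
      convert this using 1
      have h1 : ∀ i j, inner ℂ (ξ i) (matCompress T X i j (ξ j)) =
          ∑ k, ∑ l, (star (T k i) * T l j) * inner ℂ (ξ i) (X k l (ξ j)) := by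
        intro i j
        simp [matCompress, sum_apply]
      have h2 : ∀ k l, inner ℂ (∑ i, T k i • ξ i) (X k l (∑ j, T l j • ξ j)) =
          ∑ i, ∑ j, (star (T k i) * T l j) * inner ℂ (ξ i) (X k l (ξ j)) := by
        intro k l
        rw [sum_inner]
        refine Finset.sum_congr rfl fun i _ => ?_
        rw [map_sum, inner_sum]
        refine Finset.sum_congr rfl fun j _ => ?_
        rw [map_smul, inner_smul_left, inner_smul_right, starRingEnd_apply]
        ring
      simp_rw [h1, h2]
      exact (Finset.sum_congr rfl fun i _ => Finset.sum_comm).trans <| Finset.sum_comm.trans <|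
        Finset.sum_congr rfl fun k _ =>
          (Finset.sum_congr rfl fun i _ => Finset.sum_comm).trans Finset.sum_comm
  isHermitian_unit := star_one _
  order_unit {n} X hX := by
    set c := ∑ i, ∑ j, ‖X i j‖ with hc
    have hc0 : 0 ≤ c := by positivity
    refine ⟨c + 1, by linarith, ?_, fun ξ => ?_⟩
    · ext1 i j
      have := hX.apply i j
      by_cases hij : i = j
      · subst hij; simp [this]
      · simp [this, hij, Ne.symm hij]
    · rw [sub_eq_add_neg, quad_add_smul]
      have hb := quad_bound X ξ
      have him := quad_im_zero hX ξ
      set q := ∑ i, ∑ j, inner ℂ (ξ i) (X i j (ξ j)) with hq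
      have hneg : ∑ i, ∑ j, inner ℂ (ξ i) ((-X) i j (ξ j)) = -q := by simp [hq]
      rw [hneg, ← Complex.ofReal_mul]
      have hs : 0 ≤ ∑ k, ‖ξ k‖ ^ 2 := by positivity
      have := (Complex.re_le_norm q).trans hb
      refine Complex.nonneg_iff.2 ⟨?_, by
        rw [Complex.add_im, Complex.ofReal_im, Complex.neg_im, him, neg_zero, add_zero]⟩
      rw [Complex.add_re, Complex.ofReal_re, Complex.neg_re]
      nlinarith
  archimedean {n} X h := by
    refine ⟨?_, fun ξ => ?_⟩
    · have := (h 1 one_pos).1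
      ext1 i j
      have := this.apply i j
      by_cases hij : i = j
      · subst hij; simpa using this
      · simpa [hij, Ne.symm hij] using this
    · refine nonneg_of_forall_eps (c := ∑ k, ‖ξ k‖ ^ 2) (by positivity) fun r hr => ?_
      have := (h r hr).2 ξ
      rwa [quad_add_smul] at this

end BH

/-! ### The finite dimensional commutative C*-algebras `ℓ^∞(ι)` -/

lemma exists_smul_one_sub_posSemidef {n : ℕ} {M : Matrix (Fin n) (Fin n) ℂ}
    (hM : M.IsHermitian) :
    ∃ r : ℝ, 0 < r ∧ ((r : ℂ) • (1 : Matrix (Fin n) (Fin n) ℂ) - M).PosSemidef := by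
  have hX : (M.map fun z => z • (1 : ℂ →L[ℂ] ℂ)).IsHermitian := by
    ext1 i j
    rw [Matrix.conjTranspose_apply, Matrix.map_apply, Matrix.map_apply, star_smul, star_one,
      hM.apply i j]
  obtain ⟨r, hr, h⟩ := order_unit _ hX
  refine ⟨r, hr, .of_dotProduct_mulVec_nonneg ?_ fun v => ?_⟩
  · ext1 i j
    have := hM.apply i j
    by_cases hij : i = j
    · subst hij; simpa using this
    · simpa [Matrix.one_apply, hij, Ne.symm hij] using this
  · convert h.2 v using 1
    simp only [dotProduct, Matrix.mulVec, Finset.mul_sum]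
    refine Finset.sum_congr rfl fun i _ => Finset.sum_congr rfl fun j _ => ?_
    by_cases hij : i = j
    · subst hij
      simp [unit]; ring
    · simp [hij]; ring

lemma posSemidef_of_forall_eps {n : ℕ} {M : Matrix (Fin n) (Fin n) ℂ}
    (h : ∀ r : ℝ, 0 < r → ((r : ℂ) • (1 : Matrix (Fin n) (Fin n) ℂ) + M).PosSemidef) :
    M.PosSemidef := by
  refine .of_dotProduct_mulVec_nonneg ?_ fun v => ?_
  · have := (h 1 one_pos).1
    simpa using this.sub Matrix.isHermitian_one
  · refine nonneg_of_forall_eps (c := ∑ k, ‖v k‖ ^ 2) (by positivity) fun r hr => ?_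
    have := (h r hr).dotProduct_mulVec_nonneg v
    rw [Matrix.add_mulVec, dotProduct_add, Matrix.smul_mulVec, Matrix.one_mulVec,
      dotProduct_smul] at this
    convert this using 2
    simp [dotProduct, Complex.conj_mul']

open scoped MatrixOrder in
lemma eq_zero_of_posSemidef_neg {n : ℕ} {M : Matrix (Fin n) (Fin n) ℂ}
    (h : M.PosSemidef) (h' : (-M).PosSemidef) : M = 0 :=
  le_antisymm (neg_nonneg.1 (Matrix.nonneg_iff_posSemidef.2 h'))
    (Matrix.nonneg_iff_posSemidef.2 h)

/-- `ℓ^∞(ι)`, `ι` finite, as an operator system: `M_n(ℓ^∞(ι)) = ⊕_{i ∈ ι} M_n`. -/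
instance instEllInfty {ι : Type*} [Finite ι] : OperatorSystem (ι → ℂ) where
  unit := 1
  cone n := {X | ∀ i, (X.map fun u => u i).PosSemidef}
  isHermitian_of_mem {n X} h := by
    ext k l i
    exact (h i).1.apply k l
  zero_mem n i := by
    convert Matrix.PosSemidef.zero using 1
    ext; simp
  add_mem {n X Y} hX hY i := by
    convert (hX i).add (hY i) using 1
    ext; simp
  smul_mem {n r X} hr hX i := by
    convert (hX i).smul (Complex.zero_le_real.2 hr) using 1
    ext; simp
  proper {n X} hX hX' := by
    ext k l i
    exact congrFun₂ (eq_zero_of_posSemidef_neg (hX i) (by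
      convert hX' i using 1
      ext; simp)) k l
  compress_mem {n m} T {X} hX i := by
    convert (hX i).conjTranspose_mul_mul_same T using 1
    ext k l
    simp only [matCompress, Matrix.map_apply, Matrix.of_apply, Finset.sum_apply, Pi.smul_apply, smul_eq_mul,
      Matrix.mul_apply, Matrix.conjTranspose_apply, Finset.sum_mul]
    rw [Finset.sum_comm]
    exact Finset.sum_congr rfl fun a _ => Finset.sum_congr rfl fun b _ => by ring
  isHermitian_unit := star_one _
  order_unit {n} X hX := by
    have : ∀ i, ∃ r : ℝ, 0 < r ∧
        ((r : ℂ) • (1 : Matrix (Fin n) (Fin n) ℂ) - X.map fun u => u i).PosSemidef := by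
      intro i
      refine exists_smul_one_sub_posSemidef ?_
      ext k l
      exact congrFun (hX.apply k l) i
    choose r hr h using this
    have := Fintype.ofFinite ι
    refine ⟨1 + ∑ i, r i,
      add_pos_of_pos_of_nonneg one_pos (Finset.sum_nonneg fun j _ => (hr j).le), fun i => ?_⟩
    have hi : r i ≤ ∑ i, r i :=
      Finset.single_le_sum (f := r) (fun j _ => (hr j).le) (Finset.mem_univ i)
    convert (h i).add ((Matrix.PosSemidef.one (n := Fin n) (R := ℂ)).smul
      (Complex.zero_le_real.2 (show 0 ≤ 1 + ∑ i, r i - r i by linarith))) using 1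
    ext k l
    by_cases hkl : k = l
    · subst hkl; simp
    · simp [hkl]
  archimedean {n} X h i := by
    refine posSemidef_of_forall_eps fun r hr => ?_
    convert h r hr i using 1
    ext k l
    by_cases hkl : k = l
    · subst hkl; simp
    · simp [hkl]

/-! ### Quotients of operator systems by kernels -/

section quotient

variable {S : Type*} [AddCommGroup S] [Module ℂ S] [StarAddMonoid S] [StarModule ℂ S]
  [OperatorSystem S]

lemma smul_matUnit_mem (n : ℕ) {ε : ℝ} (hε : 0 ≤ ε) : (ε : ℂ) • matUnit S n ∈ cone n := by
  obtain ⟨r, hr, h⟩ := order_unit (S := S) (n := n) 0 Matrix.isHermitian_zero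
  have := smul_mem (r := ε / r) (by positivity) h
  rwa [sub_zero, smul_smul, ← Complex.ofReal_mul, div_mul_cancel₀ _ hr.ne'] at this

lemma IsState.map_star {f : S →ₗ[ℂ] ℂ} (hf : IsState f) (x : S) : f (star x) = star (f x) := by
  have herm : ∀ y : S, star y = y → (f y).im = 0 := by
    intro y hy
    obtain ⟨r, -, h⟩ := order_unit (Matrix.of fun _ _ : Fin 1 => y) (by
      ext i j; exact hy)
    have h' : Matrix.of (fun _ _ : Fin 1 => (r : ℂ) • unit - y) ∈ cone 1 := by
      have he : Matrix.of (fun _ _ : Fin 1 => (r : ℂ) • unit - y) =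
          (r : ℂ) • Matrix.diagonal (fun _ : Fin 1 => unit) - Matrix.of (fun _ _ => y) := by
        ext i j
        obtain rfl := Subsingleton.elim i j
        rw [Matrix.sub_apply, Matrix.smul_apply, Matrix.diagonal_apply_eq, Matrix.of_apply,
          Matrix.of_apply]
      rw [he]
      exact h
    have := (Complex.nonneg_iff.1 (hf.2 _ h')).2
    simpa [hf.1] using this
  have h1 := herm (x + star x) (by simp [add_comm])
  have h2 := herm (Complex.I • (x - star x)) (by simp [← smul_neg])
  simp at h1 h2
  apply Complex.ext
  · simp; linarith
  · simp; linarith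

lemma IsState.map_posSemidef {f : S →ₗ[ℂ] ℂ} (hf : IsState f) {n : ℕ}
    {X : Matrix (Fin n) (Fin n) S} (hX : X ∈ cone n) : (X.map f).PosSemidef := by
  refine .of_dotProduct_mulVec_nonneg ?_ fun v => ?_
  · ext1 i j
    rw [Matrix.conjTranspose_apply, Matrix.map_apply, ← hf.map_star,
      (isHermitian_of_mem hX).apply i j, Matrix.map_apply]
  · have := hf.2 (∑ k, ∑ l, (star (v k) * v l) • X k l)
      (compress_mem (m := 1) (Matrix.of fun k _ => v k) hX)
    convert this using 1
    simp only [dotProduct, Matrix.mulVec, Finset.mul_sum, map_sum, map_smul, smul_eq_mul]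
    exact Finset.sum_congr rfl fun a _ => Finset.sum_congr rfl fun b _ => by
      simp only [Pi.star_apply, Matrix.map_apply]; ring

variable (S) in
/-- A kernel in `S`: a subspace that is an intersection of kernels of states
(equivalently, the kernel of a completely positive map on `S`). -/
structure Kernel where
  /-- the underlying subspace -/
  carrier : Submodule ℂ S
  isKernel : ∃ F : Set (S →ₗ[ℂ] ℂ), (∀ f ∈ F, IsState f) ∧
    ∀ u, u ∈ carrier ↔ ∀ f ∈ F, f u = 0

/-- The quotient vector space `S / K`. -/
def QuotientSystem (K : Kernel S) : Type _ := S ⧸ K.carrier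

namespace QuotientSystem

variable (K : Kernel S)

instance : AddCommGroup (QuotientSystem K) := inferInstanceAs (AddCommGroup (S ⧸ K.carrier))
instance : Module ℂ (QuotientSystem K) := inferInstanceAs (Module ℂ (S ⧸ K.carrier))

/-- The quotient map. -/
def mk : S →ₗ[ℂ] QuotientSystem K := K.carrier.mkQ

lemma mk_surjective : Function.Surjective (mk K) := K.carrier.mkQ_surjective

lemma mk_eq_zero {x : S} : mk K x = 0 ↔ x ∈ K.carrier := Submodule.Quotient.mk_eq_zero _

lemma star_mem {x : S} (hx : x ∈ K.carrier) : star x ∈ K.carrier := by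
  obtain ⟨F, hF, h⟩ := K.isKernel
  rw [h] at hx ⊢
  intro f hf
  rw [(hF f hf).map_star, hx f hf, star_zero]

instance : Star (QuotientSystem K) where
  star := K.carrier.mapQ K.carrier ((starLinearEquiv ℂ : S ≃ₗ⋆[ℂ] S) : S →ₗ⋆[ℂ] S)
    (fun _ hx => star_mem K hx)

lemma star_mk (x : S) : star (mk K x) = mk K (star x) := rfl

instance : StarAddMonoid (QuotientSystem K) where
  star_involutive y := by
    obtain ⟨x, rfl⟩ := mk_surjective K y
    rw [star_mk, star_mk, star_star]
  star_add y z := by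
    obtain ⟨x, rfl⟩ := mk_surjective K y
    obtain ⟨w, rfl⟩ := mk_surjective K z
    rw [← map_add, star_mk, star_mk, star_mk, star_add, map_add]

instance : StarModule ℂ (QuotientSystem K) where
  star_smul c y := by
    obtain ⟨x, rfl⟩ := mk_surjective K y
    rw [← map_smul, star_mk, star_mk, star_smul, map_smul]

/-- The quotient operator system. A matrix over `S / K` is positive iff for every `ε > 0` it has
a lift `X` to a matrix over `S` with `ε 1 + X` positive. -/
instance instQuotient : OperatorSystem (QuotientSystem K) where
  unit := mk K unit
  cone n := {Y | ∀ ε : ℝ, 0 < ε → ∃ X : Matrix (Fin n) (Fin n) S,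
    X.map (mk K) = Y ∧ (ε : ℂ) • matUnit S n + X ∈ cone n}
  isHermitian_of_mem {n Y} h := by
    obtain ⟨X, rfl, hX⟩ := h 1 one_pos
    ext1 i j
    have := (isHermitian_of_mem hX).apply i j
    by_cases hij : i = j
    · subst hij
      simp [matUnit, isHermitian_unit] at this
      simp [star_mk, this]
    · simp [matUnit, hij, Ne.symm hij] at this
      simp [star_mk, this]
  zero_mem n ε hε := by
    refine ⟨0, by ext; simp, ?_⟩
    rw [add_zero]
    exact smul_matUnit_mem n hε.le
  add_mem {n Y Z} hY hZ ε hε := by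
    obtain ⟨X, rfl, hX⟩ := hY (ε / 2) (by positivity)
    obtain ⟨W, rfl, hW⟩ := hZ (ε / 2) (by positivity)
    refine ⟨X + W, by ext; simp, ?_⟩
    convert add_mem hX hW using 1
    rw [add_add_add_comm, ← add_smul, ← Complex.ofReal_add, add_halves]
  smul_mem {n r Y} hr hY ε hε := by
    obtain ⟨X, rfl, hX⟩ := hY (ε / (r + 1)) (by positivity)
    refine ⟨(r : ℂ) • X, by ext; simp, ?_⟩
    have h0 : 0 ≤ ε - r * (ε / (r + 1)) := by
      have : r * (ε / (r + 1)) = ε - ε / (r + 1) := by field_simp; ring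
      rw [this, sub_sub_cancel]
      positivity
    convert add_mem (smul_mem hr hX) (smul_matUnit_mem n h0) using 1
    push_cast
    module
  proper {n Y} hY hY' := by
    obtain ⟨F, hF, hK⟩ := K.isKernel
    obtain ⟨X, rfl, -⟩ := hY 1 one_pos
    have heq : ∀ f ∈ F, ∀ a b : S, mk K a = mk K b → f a = f b := by
      intro f hf a b hab
      rw [← sub_eq_zero, ← map_sub]
      exact (hK _).1 ((mk_eq_zero K).1 (by rw [map_sub, hab, sub_self])) f hf
    have key : ∀ f ∈ F, ∀ Z : Matrix (Fin n) (Fin n) S, (∀ ε : ℝ, 0 < ε →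
        ∃ W : Matrix (Fin n) (Fin n) S, W.map (mk K) = Z.map (mk K) ∧
          (ε : ℂ) • matUnit S n + W ∈ cone n) → (Z.map f).PosSemidef := by
      intro f hf Z hZ
      refine posSemidef_of_forall_eps fun ε hε => ?_
      obtain ⟨W, hW, hWc⟩ := hZ ε hε
      convert (hF f hf).map_posSemidef hWc using 1
      ext i j
      have := heq f hf _ _ (congrFun₂ hW i j)
      by_cases hij : i = j
      · subst hij
        simp [matUnit, (hF f hf).1, this]
      · simp [matUnit, hij, this]
    ext i j
    refine (mk_eq_zero K).2 ((hK _).2 fun f hf => ?_)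
    have h1 := key f hf X hY
    have h2 := key f hf (-X) (by
      intro ε hε
      obtain ⟨W, hW, hWc⟩ := hY' ε hε
      exact ⟨W, by rw [hW]; ext; simp, hWc⟩)
    exact congrFun₂ (eq_zero_of_posSemidef_neg h1 (by convert h2 using 1; ext; simp)) i j
  compress_mem {n m} T {Y} hY ε hε := by
    have hu : matUnit S n ∈ cone n := by simpa using smul_matUnit_mem (S := S) n zero_le_one
    obtain ⟨r, hr, h⟩ := order_unit _ (isHermitian_of_mem (compress_mem T hu))
    obtain ⟨X, rfl, hX⟩ := hY (ε / r) (by positivity)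
    refine ⟨matCompress T X, by ext; simp [matCompress], ?_⟩
    convert add_mem (compress_mem T hX) (smul_mem (r := ε / r) (by positivity) h) using 1
    rw [matCompress_add, matCompress_smul, smul_sub, smul_smul, ← Complex.ofReal_mul,
      div_mul_cancel₀ _ hr.ne', matUnit]
    abel
  isHermitian_unit := by rw [star_mk, isHermitian_unit]
  order_unit {n} Y hY := by
    choose g hg using mk_surjective K
    let X₀ : Matrix (Fin n) (Fin n) S := Y.map g
    let X : Matrix (Fin n) (Fin n) S := (1 / 2 : ℂ) • (X₀ + X₀.conjTranspose)
    have hX : X.IsHermitian := by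
      ext1 i j
      simp [X, add_comm]
    have hXY : X.map (mk K) = Y := by
      ext i j
      have := hY.apply i j
      simp only [X, X₀, Matrix.map_apply, Matrix.smul_apply, Matrix.add_apply,
        Matrix.conjTranspose_apply, map_smul, map_add, ← star_mk, hg, this]
      module
    obtain ⟨r, hr, h⟩ := order_unit X hX
    refine ⟨r, hr, fun ε hε => ⟨_, ?_, add_mem (smul_matUnit_mem n hε.le) h⟩⟩
    rw [← hXY]
    ext i j
    by_cases hij : i = j
    · subst hij; simp
    · simp [hij]
  archimedean {n} Y h ε hε := by
    obtain ⟨X, hX, hXc⟩ := h (ε / 2) (by positivity) (ε / 2) (by positivity)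
    refine ⟨X - ((ε / 2 : ℝ) : ℂ) • matUnit S n, ?_, ?_⟩
    · ext i j
      have := congrFun₂ hX i j
      simp only [Matrix.map_apply] at this
      by_cases hij : i = j
      · subst hij; simp [this, matUnit]
      · simp [hij, this, matUnit]
    · convert hXc using 1
      push_cast
      module

end QuotientSystem

end quotient

end OperatorSystem

/-! ### Contextuality scenarios -/

/-- A contextuality scenario: a non-empty set of subsets (edges) of a finite set `V` that
cover `V`. -/
structure ContextualityScenario (V : Type*) [Finite V] where
  edges : Finset (Finset V)
  nonempty : edges.Nonempty
  cover : ∀ x : V, ∃ e ∈ edges, x ∈ e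

namespace ContextualityScenario

variable {V : Type*} [Finite V] (G : ContextualityScenario V)

/-- Probabilistic models of `G`. -/
def IsProbModel (p : V → ℝ) : Prop :=
  (∀ x, p x ∈ Set.Icc (0 : ℝ) 1) ∧ ∀ e ∈ G.edges, ∑ x ∈ e, p x = 1

/-- `G` is non-trivial if it admits a probabilistic model. -/
def Nontrivial : Prop := ∃ p : V → ℝ, G.IsProbModel p

/-- Positive operator representations (POR) of `G` on `H`. -/
def IsPOR {H : Type*} [NormedAddCommGroup H] [InnerProductSpace ℂ H] [CompleteSpace H]
    (A : V → (H →L[ℂ] H)) : Prop :=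
  (∀ x, (A x).IsPositive) ∧ ∀ e ∈ G.edges, ∑ x ∈ e, A x = 1

/-- The type of edges of `G`. -/
abbrev Edge : Type _ := {e : Finset V // e ∈ G.edges}

/-- The space `ℓ^∞_e`. -/
abbrev EllInfty {G : ContextualityScenario V} (e : G.Edge) : Type _ := {x : V // x ∈ e.1} → ℂ

/-- The direct sum `⊕_e ℓ^∞_e`, as functions `(e, x) ↦ u_x^e` on the disjoint union of the
edges. -/
abbrev DirectSum : Type _ := (Σ e : G.Edge, {x : V // x ∈ e.1}) → ℂ

/-- The pairing `⟨p, u⟩ = ∑_e ∑_{x ∈ e} p(x) u_x^e`. -/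
def pairing (p : V → ℝ) : G.DirectSum →ₗ[ℂ] ℂ where
  toFun u := ∑ e : G.Edge, ∑ x : {x : V // x ∈ e.1}, (p x : ℂ) * u ⟨e, x⟩
  map_add' u v := by simp [mul_add, Finset.sum_add_distrib]
  map_smul' c u := by simp [Finset.mul_sum, mul_left_comm]

lemma pairing_apply (p : V → ℝ) (u : G.DirectSum) : G.pairing p u =
    ∑ e : G.Edge, ∑ x : {x : V // x ∈ e.1}, (p x : ℂ) * u ⟨e, x⟩ := rfl

/-- The subspace `{u : ⟨p, u⟩ = 0 for all probabilistic models p}` of `⊕_e ℓ^∞_e`, a kernel. -/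
def kernel : OperatorSystem.Kernel G.DirectSum where
  carrier := ⨅ p : {p : V → ℝ // G.IsProbModel p}, LinearMap.ker (G.pairing p)
  isKernel := by
    have hE : (G.edges.card : ℂ) ≠ 0 := by
      exact_mod_cast G.nonempty.card_pos.ne'
    refine ⟨{f | ∃ p, G.IsProbModel p ∧ f = (G.edges.card : ℂ)⁻¹ • G.pairing p}, ?_, ?_⟩
    · rintro f ⟨p, hp, rfl⟩
      refine ⟨?_, fun u hu => ?_⟩
      · have : ∀ e : G.Edge, ∑ x : {x : V // x ∈ e.1}, (p x : ℂ) = 1 := by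
          intro e
          rw [Finset.sum_coe_sort e.1 (fun x => (p x : ℂ))]
          exact_mod_cast hp.2 e.1 e.2
        change (G.edges.card : ℂ)⁻¹ * G.pairing p 1 = 1
        rw [pairing_apply]
        simp only [Pi.one_apply, mul_one, this]
        simp [G.nonempty.ne_empty]
      · refine mul_nonneg (inv_nonneg.2 (Nat.cast_nonneg _)) ?_
        refine Finset.sum_nonneg fun e _ => Finset.sum_nonneg fun x _ => ?_
        refine mul_nonneg (Complex.zero_le_real.2 (hp.1 x).1) ?_
        exact (hu ⟨e, x⟩).diag_nonneg (i := 0)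
    · intro u
      simp only [Submodule.mem_iInf, LinearMap.mem_ker, Subtype.forall, Set.mem_ofPred_eq]
      constructor
      · rintro h f ⟨p, hp, rfl⟩
        simp [h p hp]
      · intro h p hp
        simpa [hE, G.nonempty.ne_empty] using h _ ⟨p, hp, rfl⟩

/-- The universal operator system `S_G`, the quotient of `⊕_e ℓ^∞_e` by `kernel`. -/
abbrev SG : Type _ := OperatorSystem.QuotientSystem G.kernel

variable [DecidableEq V]

/-- The element `δ_x^e` of `ℓ^∞_e`. -/
def delta {G : ContextualityScenario V} (e : G.Edge) (x : V) : EllInfty e :=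
  fun y => if y.1 = x then 1 else 0

/-- The natural embedding `ι_e : ℓ^∞_e → ⊕_f ℓ^∞_f`. -/
def incl (e : G.Edge) : EllInfty e →ₗ[ℂ] G.DirectSum where
  toFun u i := if h : i.1 = e then u ⟨i.2.1, h ▸ i.2.2⟩ else 0
  map_add' u v := by ext i; by_cases h : i.1 = e <;> simp [h]
  map_smul' c u := by ext i; by_cases h : i.1 = e <;> simp [h]

lemma incl_apply (e : G.Edge) (u : EllInfty e) (i : Σ e : G.Edge, {x : V // x ∈ e.1}) :
    G.incl e u i = if h : i.1 = e then u ⟨i.2.1, h ▸ i.2.2⟩ else 0 := rfl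

/-- The map `i_e = |E| (q ∘ ι_e) : ℓ^∞_e → S_G`. -/
def iMap (e : G.Edge) : EllInfty e →ₗ[ℂ] G.SG :=
  (G.edges.card : ℂ) • (OperatorSystem.QuotientSystem.mk G.kernel ∘ₗ G.incl e)

/-- An edge containing a given vertex. -/
noncomputable def someEdge (x : V) : G.Edge :=
  ⟨(G.cover x).choose, (G.cover x).choose_spec.1⟩

/-- The canonical generators `a_x = i_e(δ_x^e)` of `S_G`, where `e` is any edge containing `x`. -/
noncomputable def gen (x : V) : G.SG := G.iMap (G.someEdge x) (delta (G.someEdge x) x)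

lemma pairing_incl_delta (p : V → ℝ) (e : G.Edge) {x : V} (hx : x ∈ e.1) :
    G.pairing p (G.incl e (delta e x)) = p x := by
  simp only [pairing_apply, incl_apply]
  rw [Finset.sum_eq_single e, Finset.sum_eq_single ⟨x, hx⟩]
  · simp [delta]
  · intro y _ hy
    have : y.1 ≠ x := fun h => hy (Subtype.ext h)
    simp [delta, this]
  · simp
  · intro f _ hf
    simp [hf]
  · simp

/-- `a_x` does not depend on the choice of the edge. -/
lemma iMap_delta (e : G.Edge) {x : V} (hx : x ∈ e.1) : G.iMap e (delta e x) = G.gen x := by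
  have hx' : x ∈ (G.someEdge x).1 := (G.cover x).choose_spec.2
  simp only [gen, iMap, LinearMap.smul_apply, LinearMap.comp_apply]
  congr 1
  rw [← sub_eq_zero, ← map_sub, OperatorSystem.QuotientSystem.mk_eq_zero]
  simp only [kernel, Submodule.mem_iInf, LinearMap.mem_ker]
  intro p
  rw [map_sub, pairing_incl_delta _ _ _ hx, pairing_incl_delta _ _ _ hx', sub_self]

end ContextualityScenario

open scoped Matrix

universe v

namespace OperatorSystem

/-! ### Positive functionals -/

/-! Averaging over the edges makes `S_G` universal among operator systems. Given unital completely
positive maps r_e into R that agree on shared vertices, put L(u) = |E|⁻¹ Σ_e r_e(u^e). A state s of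
R yields the probabilistic model x ↦ s(r_e(δ_x^e)), so s ∘ L vanishes on the kernel. States separate
the points of R, hence L itself vanishes there and descends to σ : S_G → R with σ ∘ i_e = r_e
(`ContextualityScenario.exists_isUCP_lift`). With R = B(H) this turns a POR into a map on `S_G`,
unique because the a_x span. Conversely, each i_e is unital and completely positive, so Φ(a_x) is
positive and sums to 1 over every edge.

For the uniqueness of `S_G`, θ is the inverse of σ. The existence clause for R says that every
unital completely positive map S_G → B(H) factors through σ. Therefore σ is injective, and a matrix
with positive image under σ is positive under all such maps, hence positive
(`mem_cone_of_forall_isUCP`). The uniqueness clause, applied to scalar-valued maps, says that states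
of R are determined on the range of σ; a dimension count then gives surjectivity
(`IsUCP.range_eq_top`).

Both detection principles, by states and by finite dimensional representations, rest on the Riesz
extension theorem (`exists_positive_functional_of_cone`). The second one also uses Choi's
correspondence between functionals on M_n(S) and maps S → M_n. -/

/-- Separation of a Hermitian vector from a proper cone with an Archimedean order unit. -/
lemma exists_positive_functional_of_cone {E : Type*} [AddCommGroup E] [Module ℂ E]
    [StarAddMonoid E] [StarModule ℂ E] (C : Set E) (u : E)
    (zero_mem : (0 : E) ∈ C) (add_mem : ∀ x ∈ C, ∀ y ∈ C, x + y ∈ C)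
    (smul_mem : ∀ (r : ℝ) (x : E), 0 ≤ r → x ∈ C → (r : ℂ) • x ∈ C)
    (star_eq : ∀ x ∈ C, star x = x)
    (proper : ∀ x ∈ C, -x ∈ C → x = 0)
    (hu : star u = u) (hu' : u ∈ C)
    (order_unit : ∀ x : E, star x = x → ∃ r : ℝ, (r : ℂ) • u - x ∈ C)
    (archimedean : ∀ x : E, (∀ r : ℝ, 0 < r → (r : ℂ) • u + x ∈ C) → x ∈ C)
    (y : E) (hy : star y = y) (hyC : y ∉ C) :
    ∃ F : E →ₗ[ℂ] ℂ, (∀ x ∈ C, 0 ≤ F x) ∧ F u = 1 ∧ F y < 0 := by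
  have hu0 : u ≠ 0 := by
    rintro rfl
    obtain ⟨r, hr⟩ := order_unit (-y) (by rw [star_neg, hy])
    exact hyC (by simpa using hr)
  -- Separation will only give g(z) ≤ 0; for z = εu + y with g(u) = 1 this still means g(y) ≤ -ε <
  -- 0.
  obtain ⟨ε, hε, hz⟩ : ∃ ε : ℝ, 0 < ε ∧ (ε : ℂ) • u + y ∉ C := by
    by_contra! h
    exact hyC (archimedean y h)
  set z : E := (ε : ℂ) • u + y with hzdef
  have hzs : star z = z := by simp [hzdef, hu, hy]
  -- P contains C and all anti-Hermitian vectors (t = 0), and also -z (t = 2).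
  let P : PointedCone ℝ E :=
    { carrier := {x | ∃ t : ℝ, 0 ≤ t ∧ x + star x + (t : ℂ) • z ∈ C}
      zero_mem' := ⟨0, le_rfl, by simpa using zero_mem⟩
      add_mem' := by
        rintro a b ⟨s, hs, ha⟩ ⟨t, ht, hb⟩
        refine ⟨s + t, by positivity, ?_⟩
        convert add_mem _ ha _ hb using 1
        rw [star_add]
        push_cast
        module
      smul_mem' := by
        rintro ⟨c, hc⟩ a ⟨s, hs, ha⟩
        refine ⟨c * s, mul_nonneg hc hs, ?_⟩
        convert smul_mem c _ hc ha using 1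
        change c • a + star (c • a) + _ = _
        rw [← Complex.coe_smul c a, star_smul]
        simp only [Complex.star_def, Complex.conj_ofReal, Complex.ofReal_mul]
        module }
  have hP : ∀ x, x ∈ P ↔ ∃ t : ℝ, 0 ≤ t ∧ x + star x + (t : ℂ) • z ∈ C := fun x => Iff.rfl
  -- For a < 0, adding -2a u to 2a u + t z ∈ C puts t z in C. This contradicts z ∉ C if t > 0; if t
  -- = 0, then 2a u ∈ C puts -u in C, against properness.
  have hneg : ∀ a : ℝ, a • u ∈ P → 0 ≤ a := by
    intro a ha
    by_contra! hlt
    obtain ⟨t, ht, h⟩ := (hP _).1 ha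
    rw [← Complex.coe_smul a u, star_smul, hu] at h
    simp only [Complex.star_def, Complex.conj_ofReal] at h
    have h1 := add_mem _ h _ (smul_mem (-(2 * a)) u (by linarith) hu')
    have h2 : (t : ℂ) • z ∈ C := by
      convert h1 using 1
      push_cast
      module
    rcases ht.eq_or_lt with rfl | ht
    · have h3 : -u ∈ C := by
        convert smul_mem (-(2 * a))⁻¹ _ (by rw [inv_nonneg]; linarith) h using 1
        have : (a : ℂ) ≠ 0 := by exact_mod_cast hlt.ne
        rw [Complex.ofReal_zero, zero_smul, add_zero, ← add_smul, smul_smul]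
        push_cast
        have e : (-(2 * (a : ℂ)))⁻¹ * (a + a) = -1 := by field_simp; ring
        rw [e]
        module
      exact hu0 (proper u hu' h3)
    · apply hz
      convert smul_mem t⁻¹ _ (by positivity) h2 using 1
      rw [smul_smul, ← Complex.ofReal_mul, inv_mul_cancel₀ ht.ne', Complex.ofReal_one, one_smul]
  -- The functional a u ↦ a on the real line through u is extended to E, staying nonnegative on P.
  obtain ⟨g, hg1, hg2⟩ := riesz_extension P
    (LinearPMap.mkSpanSingleton (σ := RingHom.id ℝ) u (1 : ℝ) hu0)
    (by
      rintro ⟨x, hx⟩ hxP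
      obtain ⟨a, rfl⟩ := Submodule.mem_span_singleton.1 hx
      rw [LinearPMap.mkSpanSingleton'_apply]
      simpa using hneg a hxP)
    (by
      intro x
      obtain ⟨r, hr⟩ := order_unit (-(x + star x)) (by simp [add_comm])
      refine ⟨⟨(r / 2) • u, Submodule.smul_mem _ _ (Submodule.mem_span_singleton_self u)⟩,
        (hP _).2 ⟨0, le_rfl, ?_⟩⟩
      convert hr using 1
      dsimp only
      rw [← Complex.coe_smul, star_add, star_smul, hu]
      simp only [Complex.star_def, Complex.conj_ofReal]
      push_cast
      module)
  have hgu : g u = 1 := by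
    have := hg1 ⟨u, Submodule.mem_span_singleton_self u⟩
    rwa [LinearPMap.mkSpanSingleton_apply] at this
  have hgC : ∀ x ∈ C, 0 ≤ g x := fun x hx => hg2 x ((hP _).2 ⟨0, le_rfl, by
    rw [star_eq x hx]
    simpa using add_mem _ hx _ hx⟩)
  have hganti : ∀ x : E, star x = -x → g x = 0 := by
    intro x hx
    refine le_antisymm ?_ ?_
    · have := hg2 (-x) ((hP _).2 ⟨0, le_rfl, by simpa [hx] using zero_mem⟩)
      rw [map_neg] at this
      linarith
    · exact hg2 x ((hP _).2 ⟨0, le_rfl, by simpa [hx] using zero_mem⟩)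
  -- The complexification is g(x) - i g(ix), and ix is anti-Hermitian when x is Hermitian.
  have hF : ∀ x : E, star x = x → (Module.Dual.extendRCLike g : Module.Dual ℂ E) x = (g x : ℂ) := by
    intro x hx
    rw [Module.Dual.extendRCLike_apply, hganti (RCLike.I • x) (by
      rw [star_smul, hx]
      simp)]
    simp
  refine ⟨Module.Dual.extendRCLike g, fun x hx => ?_, ?_, ?_⟩
  · rw [hF x (star_eq x hx)]
    exact Complex.zero_le_real.2 (hgC x hx)
  · rw [hF u hu, hgu, Complex.ofReal_one]
  · rw [hF y hy]
    have h1 : g (-z) ≥ 0 := hg2 _ ((hP _).2 ⟨2, by norm_num, by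
      convert zero_mem using 1
      rw [star_neg, hzs]
      push_cast
      module⟩)
    rw [map_neg, hzdef, map_add, Complex.coe_smul, map_smul, hgu] at h1
    have : g y < 0 := by
      simp only [smul_eq_mul, mul_one] at h1
      linarith
    exact_mod_cast this

/-! ### Separation by states, and elementary facts on cones -/

section

variable {S : Type*} [AddCommGroup S] [Module ℂ S] [StarAddMonoid S] [StarModule ℂ S]
  [OperatorSystem S]

lemma matUnit_mem (n : ℕ) : matUnit S n ∈ cone n := by
  simpa using smul_matUnit_mem (S := S) n zero_le_one

lemma exists_positive_functional {n : ℕ} {Y : Matrix (Fin n) (Fin n) S} (hY : Y.IsHermitian)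
    (hYc : Y ∉ cone n) :
    ∃ F : Matrix (Fin n) (Fin n) S →ₗ[ℂ] ℂ, (∀ X ∈ cone n, 0 ≤ F X) ∧ F (matUnit S n) = 1 ∧
      F Y < 0 :=
  exists_positive_functional_of_cone (cone n) (matUnit S n) (zero_mem n)
    (fun _ hx _ hy => add_mem hx hy) (fun _ _ hr hx => smul_mem hr hx)
    (fun _ hx => isHermitian_of_mem hx) (fun _ hx hx' => proper hx hx')
    (isHermitian_of_mem (matUnit_mem n)) (matUnit_mem n)
    (fun x hx => (order_unit x hx).imp fun _ h => h.2) archimedean Y hY hYc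

/-- A `1 × 1` matrix over `S`. -/
abbrev matOne (x : S) : Matrix (Fin 1) (Fin 1) S := Matrix.of fun _ _ => x

lemma exists_state_lt_zero {x : S} (hx : star x = x) (hxc : matOne x ∉ cone 1) :
    ∃ s : S →ₗ[ℂ] ℂ, IsState s ∧ s x < 0 := by
  obtain ⟨F, h1, h2, h3⟩ := exists_positive_functional (Y := matOne x)
    (by ext i j; exact hx) hxc
  let m : S →ₗ[ℂ] Matrix (Fin 1) (Fin 1) S :=
    { toFun := fun x => matOne x
      map_add' := fun _ _ => rfl
      map_smul' := fun _ _ => rfl }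
  refine ⟨F ∘ₗ m, ⟨?_, fun x hx => h1 _ hx⟩, h3⟩
  rw [← h2, LinearMap.comp_apply]
  congr 1
  ext i j
  obtain rfl := Subsingleton.elim i j
  rw [matUnit, Matrix.diagonal_apply_eq]
  rfl

/-- If x is Hermitian, separation places both x and -x in the cone, which is proper. The general
case follows from x + x* and i(x - x*), since states are Hermitian. -/
lemma eq_zero_of_forall_state {x : S} (h : ∀ s : S →ₗ[ℂ] ℂ, IsState s → s x = 0) : x = 0 := by
  have key : ∀ y : S, star y = y → (∀ s : S →ₗ[ℂ] ℂ, IsState s → s y = 0) → y = 0 := by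
    intro y hy hs
    have hpos : ∀ z : S, star z = z → (∀ s : S →ₗ[ℂ] ℂ, IsState s → s z = 0) →
        matOne z ∈ cone 1 := by
      intro z hz hzs
      by_contra hc
      obtain ⟨s, hs, hlt⟩ := exists_state_lt_zero hz hc
      exact hlt.ne (hzs s hs)
    have h1 := hpos y hy hs
    have h2 := hpos (-y) (by rw [star_neg, hy]) (fun s h => by rw [map_neg, hs s h, neg_zero])
    exact congrFun₂ (proper h1 h2) 0 0
  have h1 := key (x + star x) (by simp [add_comm]) fun s hs => by
    rw [map_add, hs.map_star, h s hs]; simp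
  have h2 := key (Complex.I • (x - star x)) (by simp [← smul_neg]) fun s hs => by
    rw [map_smul, map_sub, hs.map_star, h s hs]; simp
  have h3 : x - star x = 0 := by simpa using h2
  have h4 : (2 : ℂ) • x = 0 := by
    rw [← add_zero (0 : S)]
    nth_rewrite 1 [← h1]
    rw [← h3]
    module
  simpa using h4

lemma sum_mem {ι : Type*} {n : ℕ} (s : Finset ι) (X : ι → Matrix (Fin n) (Fin n) S)
    (h : ∀ i ∈ s, X i ∈ cone n) : ∑ i ∈ s, X i ∈ cone n := by
  induction s using Finset.cons_induction with
  | empty => simpa using zero_mem n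
  | cons k s hk ih =>
    rw [Finset.sum_cons]
    exact add_mem (h _ (Finset.mem_cons_self _ _))
      (ih fun i hi => h i (Finset.mem_cons_of_mem hi))

open scoped MatrixOrder in
/-- The tensor product of a positive semidefinite scalar matrix and a positive element is
positive. -/
lemma map_smul_mem_cone {n : ℕ} {M : Matrix (Fin n) (Fin n) ℂ} (hM : M.PosSemidef) {a : S}
    (ha : matOne a ∈ cone 1) : M.map (fun z => z • a) ∈ cone n := by
  -- With M = B*B, the tensor M ⊗ a is the sum of the compressions of a by the rows of B.
  obtain ⟨B, rfl⟩ := CStarAlgebra.nonneg_iff_eq_star_mul_self.mp hM.nonneg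
  convert sum_mem Finset.univ
    (fun k => matCompress (Matrix.of fun (_ : Fin 1) i => B k i) (matOne a))
    (fun _ _ => compress_mem _ ha) using 1
  ext i j
  simp [matCompress, Matrix.mul_apply, Matrix.sum_apply, Finset.sum_smul]

lemma IsCP.comp {T U : Type*} [AddCommGroup T] [Module ℂ T] [StarAddMonoid T] [StarModule ℂ T]
    [OperatorSystem T] [AddCommGroup U] [Module ℂ U] [StarAddMonoid U] [StarModule ℂ U]
    [OperatorSystem U] {ψ : T →ₗ[ℂ] U} {φ : S →ₗ[ℂ] T} (hψ : IsCP ψ) (hφ : IsCP φ) :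
    IsCP (ψ ∘ₗ φ) := fun n X hX => hψ n _ (hφ n X hX)

lemma IsUCP.comp {T U : Type*} [AddCommGroup T] [Module ℂ T] [StarAddMonoid T] [StarModule ℂ T]
    [OperatorSystem T] [AddCommGroup U] [Module ℂ U] [StarAddMonoid U] [StarModule ℂ U]
    [OperatorSystem U] {ψ : T →ₗ[ℂ] U} {φ : S →ₗ[ℂ] T} (hψ : IsUCP ψ) (hφ : IsUCP φ) :
    IsUCP (ψ ∘ₗ φ) :=
  ⟨by rw [LinearMap.comp_apply, hφ.1, hψ.1], hψ.2.comp hφ.2⟩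

end

/-! ### Positive operators and scalar-valued maps -/

section BH

variable {S : Type*} [AddCommGroup S] [Module ℂ S] [StarAddMonoid S] [StarModule ℂ S]
  [OperatorSystem S]
variable {H : Type*} [NormedAddCommGroup H] [InnerProductSpace ℂ H] [CompleteSpace H]

lemma matOne_mem_cone_iff {A : H →L[ℂ] H} : matOne A ∈ cone 1 ↔ A.IsPositive := by
  rw [ContinuousLinearMap.isPositive_iff']
  constructor
  · rintro ⟨h1, h2⟩
    refine ⟨h1.apply 0 0, fun x => ?_⟩
    have := h2 fun _ => x
    simp only [Finset.univ_unique, Finset.sum_singleton, Matrix.of_apply] at this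
    rwa [← ContinuousLinearMap.adjoint_inner_right, show ContinuousLinearMap.adjoint A = A from
      h1.apply 0 0]
  · rintro ⟨h1, h2⟩
    refine ⟨by ext1 i j; exact h1, fun ξ => ?_⟩
    simp only [Finset.univ_unique, Finset.sum_singleton, Matrix.of_apply]
    rw [← ContinuousLinearMap.adjoint_inner_left, show ContinuousLinearMap.adjoint A = A from h1]
    exact h2 _

/-- A state, viewed as a unital completely positive map into the scalar operators. -/
lemma IsState.isUCP_smulRight {s : S →ₗ[ℂ] ℂ} (hs : IsState s) :
    IsUCP (s.smulRight (1 : H →L[ℂ] H)) := by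
  refine ⟨?_, fun n X hX => ?_⟩
  · rw [LinearMap.smulRight_apply, hs.1, one_smul]
    rfl
  · exact map_smul_mem_cone (hs.map_posSemidef hX)
      (matOne_mem_cone_iff.2 ContinuousLinearMap.isPositive_one)

end BH

/-! ### Positive functionals on matrices and completely positive maps -/

section

variable {S : Type*} [AddCommGroup S] [Module ℂ S]
  {ι : Type*} [Fintype ι] [DecidableEq ι] {n : ℕ}

lemma matCompress_matCompress {m k : ℕ} (T : Matrix (Fin n) (Fin m) ℂ)
    (U : Matrix (Fin m) (Fin k) ℂ) (X : Matrix (Fin n) (Fin n) S) :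
    matCompress U (matCompress T X) = matCompress (T * U) X := by
  ext i j
  simp only [matCompress, Matrix.of_apply, Matrix.mul_apply, Finset.smul_sum, smul_smul, star_sum,
    Finset.sum_mul_sum, Finset.sum_smul, star_mul']
  have : ∀ a b c d, star (U a i) * U b j * (star (T c a) * T d b) =
      star (T c a) * star (U a i) * (T d b * U b j) := fun a b c d => by ring
  simp_rw [this]
  calc _ = ∑ a, ∑ c, ∑ b, ∑ d, (star (T c a) * star (U a i) * (T d b * U b j)) • X c d :=
        Finset.sum_congr rfl fun a _ => Finset.sum_comm
    _ = ∑ c, ∑ a, ∑ b, ∑ d, (star (T c a) * star (U a i) * (T d b * U b j)) • X c d :=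
        Finset.sum_comm
    _ = ∑ c, ∑ a, ∑ d, ∑ b, (star (T c a) * star (U a i) * (T d b * U b j)) • X c d :=
        Finset.sum_congr rfl fun c _ => Finset.sum_congr rfl fun a _ => Finset.sum_comm
    _ = _ := Finset.sum_congr rfl fun c _ => Finset.sum_comm

lemma matCompress_one (X : Matrix (Fin n) (Fin n) S) : matCompress 1 X = X := by
  ext i j
  simp only [matCompress, Matrix.of_apply]
  rw [Finset.sum_eq_single i, Finset.sum_eq_single j]
  · simp
  · intro b _ hb; simp [hb]
  · simp
  · intro b _ hb; simp [hb]
  · simp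

lemma matCompress_single (i j : Fin n) (X : Matrix (Fin n) (Fin n) S) :
    matCompress (Matrix.single j i (1 : ℂ)) X = Matrix.single i i (X j j) := by
  ext a b
  simp only [matCompress, Matrix.of_apply]
  rw [Finset.sum_eq_single j, Finset.sum_eq_single j]
  · by_cases ha : i = a <;> by_cases hb : i = b <;> simp [Matrix.single_apply, ha, hb]
  · intro c _ hc; simp [Matrix.single_apply, hc.symm]
  · simp
  · intro c _ hc; simp [Matrix.single_apply, hc.symm]
  · simp

/-- Compression by a fixed scalar matrix as a linear map. -/
def compressLin {m : ℕ} (T : Matrix (Fin n) (Fin m) ℂ) :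
    Matrix (Fin n) (Fin n) S →ₗ[ℂ] Matrix (Fin m) (Fin m) S where
  toFun := matCompress T
  map_add' := matCompress_add T
  map_smul' := matCompress_smul T

/-- The map `S → B(ℂⁿ)` with matrix entries `F (E_{ij} ⊗ s)`. -/
noncomputable def choiMap (F : Matrix (Fin n) (Fin n) S →ₗ[ℂ] ℂ) (e : ι ≃ Fin n) :
    S →ₗ[ℂ] (EuclideanSpace ℂ ι →L[ℂ] EuclideanSpace ℂ ι) where
  toFun s := Matrix.toEuclideanCLM (𝕜 := ℂ) (n := ι)
    (Matrix.of fun i j => F (Matrix.single (e i) (e j) s))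
  map_add' s t := by
    rw [← map_add]
    congr 1
    ext i j
    simp [Matrix.single_add]
  map_smul' c s := by
    rw [← map_smul]
    congr 1
    ext i j
    simp [← Matrix.smul_single]

lemma choiMap_apply (F : Matrix (Fin n) (Fin n) S →ₗ[ℂ] ℂ) (e : ι ≃ Fin n) (s : S) :
    choiMap F e s = Matrix.toEuclideanCLM (𝕜 := ℂ) (n := ι)
      (Matrix.of fun i j => F (Matrix.single (e i) (e j) s)) := rfl

/-- This identity is the heart of Choi's correspondence: the vectors ξ_a are the rows of a scalar
matrix, so positivity of F at a compression of X is positivity of the quadratic form of the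
amplified map at X. -/
lemma quad_choiMap (F : Matrix (Fin n) (Fin n) S →ₗ[ℂ] ℂ) (e : ι ≃ Fin n) {m : ℕ}
    (X : Matrix (Fin m) (Fin m) S) (ξ : Fin m → EuclideanSpace ℂ ι) :
    ∑ a, ∑ b, inner ℂ (ξ a) (choiMap F e (X a b) (ξ b)) =
      F (matCompress (Matrix.of fun a i => ξ a (e.symm i)) X) := by
  have hF : ∀ M : Matrix (Fin n) (Fin n) S, F M = ∑ i, ∑ j, F (Matrix.single i j (M i j)) := by
    intro M
    conv_lhs => rw [Matrix.matrix_eq_sum_single M]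
    simp only [map_sum]
  have h1 : ∀ a b, inner ℂ (ξ a) (choiMap F e (X a b) (ξ b)) =
      ∑ i, ∑ j, star (ξ a (e.symm i)) * ξ b (e.symm j) * F (Matrix.single i j (X a b)) := by
    intro a b
    rw [choiMap_apply, PiLp.inner_apply, ← e.symm.sum_comp]
    refine Finset.sum_congr rfl fun i _ => ?_
    rw [Matrix.ofLp_toEuclideanCLM, Matrix.mulVec, dotProduct, inner_sum, ← e.symm.sum_comp]
    refine Finset.sum_congr rfl fun j _ => ?_
    simp
    ring
  rw [hF]
  simp_rw [h1]
  have h2 : ∀ i j, F (Matrix.single i j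
      (matCompress (Matrix.of fun a i => ξ a (e.symm i)) X i j)) =
      ∑ a, ∑ b, star (ξ a (e.symm i)) * ξ b (e.symm j) * F (Matrix.single i j (X a b)) := by
    intro i j
    have : (F ∘ₗ Matrix.singleLinearMap ℂ i j)
        (∑ a, ∑ b, (star (ξ a (e.symm i)) * ξ b (e.symm j)) • X a b) =
        ∑ a, ∑ b, star (ξ a (e.symm i)) * ξ b (e.symm j) *
          (F ∘ₗ Matrix.singleLinearMap ℂ i j) (X a b) := by
      simp only [map_sum, map_smul, smul_eq_mul]
    exact this
  simp_rw [h2]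
  exact (Finset.sum_congr rfl fun i _ => Finset.sum_comm).trans <| Finset.sum_comm.trans <|
    Finset.sum_congr rfl fun k _ =>
      (Finset.sum_congr rfl fun i _ => Finset.sum_comm).trans Finset.sum_comm

variable [StarAddMonoid S] [StarModule ℂ S] [OperatorSystem S]

/-- Positive linear functionals on `M_n(S)`. -/
def IsPosFunctional (F : Matrix (Fin n) (Fin n) S →ₗ[ℂ] ℂ) : Prop :=
  ∀ X ∈ cone n, 0 ≤ F X

namespace IsPosFunctional

variable {F : Matrix (Fin n) (Fin n) S →ₗ[ℂ] ℂ}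

lemma im_eq_zero (hF : IsPosFunctional F) {X : Matrix (Fin n) (Fin n) S} (hX : X.IsHermitian) :
    (F X).im = 0 := by
  obtain ⟨r, -, h⟩ := order_unit X hX
  have h1 := (Complex.nonneg_iff.1 (hF _ h)).2
  have h2 := (Complex.nonneg_iff.1 (hF _ (matUnit_mem n))).2
  rw [matUnit] at h2
  rw [map_sub, map_smul, Complex.sub_im, smul_eq_mul, Complex.im_ofReal_mul, ← h2] at h1
  linarith

lemma map_conjTranspose (hF : IsPosFunctional F) (X : Matrix (Fin n) (Fin n) S) :
    F X.conjTranspose = star (F X) := by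
  have h1 := hF.im_eq_zero (X := X + X.conjTranspose) (by
    ext1 i j; simp [add_comm])
  have h2 := hF.im_eq_zero (X := Complex.I • (X - X.conjTranspose)) (by
    ext1 i j; simp [← smul_neg])
  simp at h1 h2
  apply Complex.ext
  · simp; linarith
  · simp; linarith

lemma comp_compressLin (hF : IsPosFunctional F) {m : ℕ} (T : Matrix (Fin m) (Fin n) ℂ) :
    IsPosFunctional (F ∘ₗ compressLin T) := fun _ hX => hF _ (compress_mem T hX)

end IsPosFunctional

lemma IsPosFunctional.isCP_choiMap {F : Matrix (Fin n) (Fin n) S →ₗ[ℂ] ℂ}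
    (hF : IsPosFunctional F) (e : ι ≃ Fin n) : IsCP (choiMap F e) := by
  intro m X hX
  refine ⟨?_, fun ξ => ?_⟩
  · ext1 a b
    rw [Matrix.conjTranspose_apply, Matrix.map_apply, Matrix.map_apply, choiMap_apply,
      choiMap_apply, ← map_star]
    congr 1
    ext i j
    rw [Matrix.star_apply, Matrix.of_apply, Matrix.of_apply, ← hF.map_conjTranspose,
      Matrix.conjTranspose_single, (isHermitian_of_mem hX).apply]
  · have := hF _ (compress_mem (Matrix.of fun a i => ξ a (e.symm i)) hX)
    rwa [← quad_choiMap] at this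

lemma choiMap_unit {F : Matrix (Fin n) (Fin n) S →ₗ[ℂ] ℂ} (e : ι ≃ Fin n)
    (h : ∀ i j, F (Matrix.single i j unit) = (1 : Matrix (Fin n) (Fin n) ℂ) i j) :
    choiMap F e (unit : S) = 1 := by
  rw [choiMap_apply, ← map_one (Matrix.toEuclideanCLM (𝕜 := ℂ) (n := ι))]
  congr 1
  ext i j
  simp [h, Matrix.one_apply]

/-- Serves to normalise F: precomposition with compression by C conjugates the matrix [F(E_kl ⊗ 1)],
so a suitable C turns it into the identity. -/
lemma compress_single_unit (C : Matrix (Fin n) (Fin n) ℂ) (F : Matrix (Fin n) (Fin n) S →ₗ[ℂ] ℂ)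
    (i j : Fin n) : F (matCompress C (Matrix.single i j (unit : S))) =
      (Cᵀ.conjTranspose * (Matrix.of fun k l => F (Matrix.single k l (unit : S))) * Cᵀ) i j := by
  have h : matCompress C (Matrix.single i j (unit : S)) =
      ∑ k, ∑ l, (star (C i k) * C j l) • Matrix.single k l (unit : S) := by
    ext a b
    simp only [matCompress, Matrix.of_apply, Matrix.sum_apply, Matrix.smul_apply]
    rw [Finset.sum_eq_single i, Finset.sum_eq_single j, Finset.sum_eq_single a,
      Finset.sum_eq_single b]
    · simp
    · intro c _ hc; simp [hc]
    · simp
    · intro c _ hc; simp [hc]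
    · simp
    · intro c _ hc; simp [hc.symm]
    · simp
    · intro c _ hc; simp [hc.symm]
    · simp
  rw [h, Matrix.mul_apply]
  simp only [map_sum, map_smul, smul_eq_mul, Matrix.mul_apply, Finset.sum_mul,
    Matrix.conjTranspose_apply, Matrix.transpose_apply, Matrix.of_apply]
  rw [Finset.sum_comm]
  exact Finset.sum_congr rfl fun k _ => Finset.sum_congr rfl fun l _ => by ring

/-- The quadratic form of this matrix at v is F evaluated at the compression of the 1 × 1 unit by
the row v. -/
lemma IsPosFunctional.posSemidef {F : Matrix (Fin n) (Fin n) S →ₗ[ℂ] ℂ}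
    (hF : IsPosFunctional F) :
    (Matrix.of fun k l => F (Matrix.single k l (unit : S))).PosSemidef := by
  refine .of_dotProduct_mulVec_nonneg ?_ fun v => ?_
  · ext1 i j
    rw [Matrix.conjTranspose_apply, Matrix.of_apply, Matrix.of_apply, ← hF.map_conjTranspose,
      Matrix.conjTranspose_single, isHermitian_unit]
  · have hu : matOne (unit : S) ∈ cone 1 := by
      convert matUnit_mem (S := S) 1 using 1
      ext i j
      obtain rfl := Subsingleton.elim i j
      rw [matUnit, Matrix.diagonal_apply_eq]
      rfl
    have h := hF _ (compress_mem (Matrix.of fun (_ : Fin 1) k => v k) hu)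
    rw [Matrix.matrix_eq_sum_single (matCompress _ _)] at h
    convert h using 1
    have h2 : ∀ i j, F (Matrix.single i j
        (matCompress (Matrix.of fun (_ : Fin 1) k => v k) (matOne (unit : S)) i j)) =
        star (v i) * v j * F (Matrix.single i j (unit : S)) := by
      intro i j
      have := (F ∘ₗ Matrix.singleLinearMap ℂ i j).map_smul (star (v i) * v j) (unit : S)
      simp only [matCompress, Matrix.of_apply, Finset.univ_unique, Finset.sum_singleton]
      exact this
    simp only [map_sum, h2, dotProduct, Matrix.mulVec, Finset.mul_sum]
    exact Finset.sum_congr rfl fun k _ => Finset.sum_congr rfl fun l _ => by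
      simp only [Pi.star_apply, Matrix.of_apply]; ring

/-- A separating functional may have a singular matrix [F(E_kl ⊗ 1)] and then could not be
normalised. Adding a small multiple of a positive functional τ with τ(E_ab ⊗ 1) = δ_ab makes it
definite and keeps the value at Y negative. -/
lemma exists_posDef_functional {Y : Matrix (Fin n) (Fin n) S} (hY : Y.IsHermitian)
    (hYc : Y ∉ cone n) : ∃ F : Matrix (Fin n) (Fin n) S →ₗ[ℂ] ℂ, IsPosFunctional F ∧
      (Matrix.of fun k l => F (Matrix.single k l (unit : S))).PosDef ∧ (F Y).re < 0 := by
  obtain ⟨F, hF, hF1, hFY⟩ := exists_positive_functional hY hYc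
  have hFp : IsPosFunctional F := hF
  -- Compression by E_ji sends X to E_ii ⊗ X_jj, so τ is positive and τ(E_aa ⊗ 1) = F(1) = 1.
  let τ : Matrix (Fin n) (Fin n) S →ₗ[ℂ] ℂ :=
    ∑ i, ∑ j, F ∘ₗ compressLin (Matrix.single j i (1 : ℂ))
  have hτ : ∀ X, τ X = ∑ i, ∑ j, F (Matrix.single i i (X j j)) := by
    intro X
    simp only [τ, LinearMap.sum_apply]
    exact Finset.sum_congr rfl fun i _ => Finset.sum_congr rfl fun j _ =>
      congrArg F (matCompress_single i j X)
  have hτp : IsPosFunctional τ := by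
    intro X hX
    simp only [τ, LinearMap.sum_apply]
    exact Finset.sum_nonneg fun i _ => Finset.sum_nonneg fun j _ => hFp.comp_compressLin _ X hX
  have hτ1 : ∀ a b, τ (Matrix.single a b unit) = (1 : Matrix (Fin n) (Fin n) ℂ) a b := by
    intro a b
    rw [hτ]
    by_cases hab : a = b
    · subst hab
      rw [Matrix.one_apply_eq, ← hF1, Matrix.matrix_eq_sum_single (matUnit S n), map_sum]
      refine Finset.sum_congr rfl fun i _ => ?_
      rw [map_sum, Finset.sum_eq_single a, Finset.sum_eq_single i]
      · simp [matUnit]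
      · intro c _ hc; simp [matUnit, hc.symm]
      · simp
      · intro c _ hc; simp [hc.symm]
      · simp
    · rw [Matrix.one_apply_ne hab]
      refine Finset.sum_eq_zero fun i _ => Finset.sum_eq_zero fun j _ => ?_
      rw [Matrix.single_apply_of_ne, Matrix.single_zero, map_zero]
      rintro ⟨rfl, rfl⟩
      exact hab rfl
  have hre : (F Y).re < 0 := (Complex.lt_def.1 hFY).1
  -- Chosen so that δ|τ(Y)| stays below half of |F(Y)| (real parts); the added 1 avoids division by
  -- zero.
  set δ : ℝ := -(F Y).re / (2 * (|(τ Y).re| + 1)) with hδ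
  have hδ0 : 0 < δ := div_pos (by linarith) (by positivity)
  refine ⟨F + (δ : ℂ) • τ, fun X hX => ?_, ?_, ?_⟩
  · exact add_nonneg (hFp X hX) (mul_nonneg (Complex.zero_le_real.2 hδ0.le) (hτp X hX))
  · have := (Matrix.PosDef.one (n := Fin n) (R := ℂ)).smul (Complex.zero_lt_real.2 hδ0)
    convert Matrix.PosDef.posSemidef_add hFp.posSemidef this using 1
    ext i j
    simp [hτ1]
  · rw [LinearMap.add_apply, LinearMap.smul_apply, smul_eq_mul, Complex.add_re,
      Complex.re_ofReal_mul]
    have h1 : δ * (τ Y).re ≤ δ * (|(τ Y).re| + 1) :=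
      mul_le_mul_of_nonneg_left (by linarith [le_abs_self (τ Y).re]) hδ0.le
    have h2 : δ * (|(τ Y).re| + 1) = -(F Y).re / 2 := by
      rw [hδ]
      field_simp
    linarith

open scoped MatrixOrder in
/-- Finite dimensional representations detect positivity in matrices over an operator system. -/
theorem mem_cone_of_forall_isUCP {Y : Matrix (Fin n) (Fin n) S} (hY : Y.IsHermitian)
    (h : ∀ (H : Type v) [NormedAddCommGroup H] [InnerProductSpace ℂ H] [CompleteSpace H]
      (φ : S →ₗ[ℂ] (H →L[ℂ] H)), IsUCP φ →
        Y.map φ ∈ (cone n : Set (Matrix (Fin n) (Fin n) (H →L[ℂ] H)))) : Y ∈ cone n := by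
  by_contra hYc
  obtain ⟨F, hF, hP, hFY⟩ := exists_posDef_functional hY hYc
  set M : Matrix (Fin n) (Fin n) ℂ := Matrix.of fun k l => F (Matrix.single k l (unit : S))
  obtain ⟨B, hB⟩ := CStarAlgebra.nonneg_iff_eq_star_mul_self.mp hP.posSemidef.nonneg
  have hBu : IsUnit B.det := by
    have := (Matrix.isUnit_iff_isUnit_det _).1 hP.isUnit
    rw [hB, Matrix.det_mul] at this
    exact isUnit_of_mul_isUnit_right this
  -- Since M = B*B, conjugating M by Cᵀ = B⁻¹ gives the identity, so the map attached to F ∘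
  -- `compressLin C` is unital.
  set C : Matrix (Fin n) (Fin n) ℂ := (B⁻¹)ᵀ with hC
  have hTC : Bᵀ * C = 1 := by
    rw [hC, ← Matrix.transpose_mul, Matrix.nonsing_inv_mul _ hBu, Matrix.transpose_one]
  -- `ULift` places the n-dimensional Hilbert space in the universe of the hypothesis.
  let e : ULift.{v} (Fin n) ≃ Fin n := Equiv.ulift
  have hc := h (EuclideanSpace ℂ (ULift.{v} (Fin n))) (choiMap (F ∘ₗ compressLin C) e)
    ⟨choiMap_unit e fun i j => ?_, (hF.comp_compressLin C).isCP_choiMap e⟩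
  rotate_left
  · refine (compress_single_unit C F i j).trans ?_
    change (Cᵀ.conjTranspose * M * Cᵀ) i j = _
    rw [hB, hC, Matrix.transpose_transpose, Matrix.star_eq_conjTranspose, ← Matrix.mul_assoc,
      ← Matrix.conjTranspose_mul, Matrix.mul_assoc, Matrix.mul_nonsing_inv _ hBu,
      Matrix.conjTranspose_one, Matrix.one_mul]
  -- The columns of B as test vectors undo the normalisation: compressing by Bᵀ and then by C is the
  -- identity, so the quadratic form equals F(Y).
  · have h := hc.2 fun a => WithLp.toLp 2 fun i => B (e i) a
    simp only [Matrix.map_apply] at h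
    rw [quad_choiMap] at h
    simp only [Equiv.apply_symm_apply] at h
    change 0 ≤ F (matCompress C (matCompress Bᵀ Y)) at h
    rw [matCompress_matCompress, hTC, matCompress_one] at h
    exact absurd (Complex.nonneg_iff.1 h).1 (not_le.2 hFY)

end

/-- A one-dimensional H in the given universe suffices. This reduces equations between states to
equations between scalar operators. -/
lemma eq_of_forall_smul_one_eq {z w : ℂ}
    (h : ∀ (H : Type v) [NormedAddCommGroup H] [InnerProductSpace ℂ H] [CompleteSpace H],
      z • (1 : H →L[ℂ] H) = w • (1 : H →L[ℂ] H)) : z = w := by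
  have h1 := congrArg (fun T => T (WithLp.toLp 2 fun _ => (1 : ℂ)) ⟨0⟩)
    (h (EuclideanSpace ℂ (ULift.{v} (Fin 1))))
  simpa using h1

section

variable {S R : Type*} [AddCommGroup S] [Module ℂ S] [StarAddMonoid S] [StarModule ℂ S]
  [OperatorSystem S] [AddCommGroup R] [Module ℂ R] [StarAddMonoid R] [StarModule ℂ R]
  [OperatorSystem R]

/-! ### Unital completely positive maps and states -/

lemma IsState.comp {s : R →ₗ[ℂ] ℂ} (hs : IsState s) {φ : S →ₗ[ℂ] R} (hφ : IsUCP φ) :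
    IsState (s ∘ₗ φ) :=
  ⟨by rw [LinearMap.comp_apply, hφ.1, hs.1], fun x hx => hs.2 _ (hφ.2 1 _ hx)⟩

/-- For a state s both s and s ∘ φ are Hermitian, and states separate points. -/
lemma IsUCP.map_star {φ : S →ₗ[ℂ] R} (hφ : IsUCP φ) (x : S) : φ (star x) = star (φ x) := by
  rw [← sub_eq_zero]
  refine eq_zero_of_forall_state fun s hs => ?_
  rw [map_sub, hs.map_star, sub_eq_zero]
  exact (hs.comp hφ).map_star x

lemma sum_smul_isState {ι : Type*} (F : Finset ι) {f : ι → S →ₗ[ℂ] ℂ}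
    (hf : ∀ i, IsState (f i)) {a : ι → ℝ} (ha : ∀ i, 0 ≤ a i) (h0 : 0 < ∑ i ∈ F, a i) :
    IsState (((∑ i ∈ F, a i : ℝ) : ℂ)⁻¹ • ∑ i ∈ F, (a i : ℂ) • f i) := by
  refine ⟨?_, fun x hx => ?_⟩
  · have : ((∑ i ∈ F, a i : ℝ) : ℂ) ≠ 0 := by exact_mod_cast h0.ne'
    simp only [LinearMap.smul_apply, LinearMap.sum_apply, (hf _).1, smul_eq_mul, mul_one]
    rw [← Complex.ofReal_sum]
    exact inv_mul_cancel₀ this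
  · simp only [LinearMap.smul_apply, LinearMap.sum_apply, smul_eq_mul]
    rw [← Complex.ofReal_inv]
    exact mul_nonneg (Complex.zero_le_real.2 (inv_nonneg.2 h0.le)) <|
      Finset.sum_nonneg fun i _ => mul_nonneg (Complex.zero_le_real.2 (ha i)) ((hf i).2 x hx)

/-- Split the coefficients into positive and negative parts. Evaluation at the unit shows that both
parts have the same mass; if it is nonzero, normalising gives two states that agree on the range of
σ, hence are equal. -/
lemma sum_real_smul_state_eq_zero {σ : S →ₗ[ℂ] R} (hσ : IsUCP σ)
    (h : ∀ s t : R →ₗ[ℂ] ℂ, IsState s → IsState t → s ∘ₗ σ = t ∘ₗ σ → s = t)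
    {ι : Type*} (F : Finset ι) {f : ι → R →ₗ[ℂ] ℂ} (hf : ∀ i, IsState (f i)) (a : ι → ℝ)
    (ha : ∀ y, ∑ i ∈ F, (a i : ℂ) * f i (σ y) = 0) : ∑ i ∈ F, (a i : ℂ) • f i = 0 := by
  have hsplit : ∀ i, (a i : ℂ) = ((a i)⁺ : ℝ) - ((a i)⁻ : ℝ) := fun i => by
    rw [← Complex.ofReal_sub, posPart_sub_negPart]
  have hsum : ∑ i ∈ F, (a i)⁺ = ∑ i ∈ F, (a i)⁻ := by
    have := ha unit
    simp only [hσ.1, (hf _).1, mul_one] at this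
    rw [← Complex.ofReal_sum, Complex.ofReal_eq_zero] at this
    rw [← sub_eq_zero, ← Finset.sum_sub_distrib]
    simpa only [posPart_sub_negPart] using this
  rcases (Finset.sum_nonneg fun i _ => posPart_nonneg (a i) : 0 ≤ ∑ i ∈ F, (a i)⁺).eq_or_lt with
    h0 | h0
  · have h1 := (Finset.sum_eq_zero_iff_of_nonneg fun i _ => posPart_nonneg (a i)).1 h0.symm
    have h2 := (Finset.sum_eq_zero_iff_of_nonneg fun i _ => negPart_nonneg (a i)).1
      (hsum.symm.trans h0.symm)
    refine Finset.sum_eq_zero fun i hi => ?_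
    rw [hsplit, h1 i hi, h2 i hi]
    simp
  · have hp := sum_smul_isState F hf (fun i => posPart_nonneg (a i)) h0
    have hn := sum_smul_isState F hf (fun i => negPart_nonneg (a i)) (hsum ▸ h0)
    have hne : ((∑ i ∈ F, (a i)⁺ : ℝ) : ℂ)⁻¹ ≠ 0 := by
      refine inv_ne_zero ?_
      exact_mod_cast h0.ne'
    have heq := h _ _ hp hn (by
      ext y
      rw [← hsum]
      simp only [LinearMap.comp_apply, LinearMap.smul_apply, LinearMap.sum_apply, smul_eq_mul]
      congr 1
      rw [← sub_eq_zero, ← Finset.sum_sub_distrib, ← ha y]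
      exact Finset.sum_congr rfl fun i _ => by rw [hsplit]; ring)
    rw [← hsum] at heq
    have := smul_right_injective _ hne heq
    rw [← sub_eq_zero, ← Finset.sum_sub_distrib] at this
    rw [← this]
    exact Finset.sum_congr rfl fun i _ => by rw [hsplit, sub_smul]

/-- A unital completely positive map with finite dimensional domain is surjective if the states of
the codomain are determined by their restriction to the range. -/
theorem IsUCP.range_eq_top [FiniteDimensional ℂ S] {σ : S →ₗ[ℂ] R} (hσ : IsUCP σ)
    (h : ∀ s t : R →ₗ[ℂ] ℂ, IsState s → IsState t → s ∘ₗ σ = t ∘ₗ σ → s = t) :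
    LinearMap.range σ = ⊤ := by
  let f : {s : R →ₗ[ℂ] ℂ // IsState s} → Module.Dual ℂ R := fun s => s.1
  let D : Submodule ℂ (Module.Dual ℂ R) := Submodule.span ℂ (Set.range f)
  let W := LinearMap.range σ
  have key : ∀ φ ∈ D, (∀ y, φ (σ y) = 0) → φ = 0 := by
    intro φ hφ h0
    obtain ⟨c, rfl⟩ := Finsupp.mem_span_range_iff_exists_finsupp.1 hφ
    simp only [Finsupp.sum, LinearMap.sum_apply, LinearMap.smul_apply, smul_eq_mul] at h0 ⊢
    have hf : ∀ i, IsState (f i) := fun i => i.2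
    -- The range of σ is closed under the involution and states are Hermitian, so the conjugated
    -- coefficients also give zero there. Real and imaginary parts can then be treated separately.
    have h1 : ∀ y, ∑ i ∈ c.support, star (c i) * f i (σ y) = 0 := by
      intro y
      have := congrArg star (h0 (star y))
      simpa [hσ.map_star, (hf _).map_star] using this
    have hre := sum_real_smul_state_eq_zero hσ h c.support hf (fun i => (c i).re) (fun y => by
      have := congrArg₂ (· + ·) (h0 y) (h1 y)
      simp only [← Finset.sum_add_distrib, ← add_mul, Complex.star_def, Complex.add_conj] at this
      simpa [mul_assoc, ← Finset.mul_sum] using this)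
    have him := sum_real_smul_state_eq_zero hσ h c.support hf (fun i => (c i).im) (fun y => by
      have := congrArg₂ (· - ·) (h0 y) (h1 y)
      simp only [← Finset.sum_sub_distrib, ← sub_mul, Complex.star_def, Complex.sub_conj] at this
      have e : ∀ i, ((2 * (c i).im : ℝ) : ℂ) * Complex.I * f i (σ y) =
          (2 * Complex.I) * ((c i).im * f i (σ y)) := fun i => by push_cast; ring
      simp only [e, ← Finset.mul_sum] at this
      simpa using this)
    calc _ = ∑ i ∈ c.support, ((c i).re : ℂ) • f i +
          Complex.I • ∑ i ∈ c.support, ((c i).im : ℂ) • f i := by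
          rw [Finset.smul_sum, ← Finset.sum_add_distrib]
          refine Finset.sum_congr rfl fun i _ => ?_
          rw [smul_smul, ← add_smul, mul_comm, Complex.re_add_im]
      _ = 0 := by rw [hre, him, smul_zero, add_zero]
  -- Restriction embeds the span D of the states into the dual of the range W, and R embeds into the
  -- dual of D. Hence dim R ≤ dim D ≤ dim W.
  let ρ : D →ₗ[ℂ] Module.Dual ℂ W := W.subtype.dualMap ∘ₗ D.subtype
  have hρ : Function.Injective ρ := by
    rw [← LinearMap.ker_eq_bot, LinearMap.ker_eq_bot']
    intro φ hφ
    exact Subtype.ext (key φ.1 φ.2 fun y =>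
      LinearMap.congr_fun hφ (⟨σ y, LinearMap.mem_range_self σ y⟩ : W))
  have : FiniteDimensional ℂ D := Module.Finite.of_injective ρ hρ
  let ev : R →ₗ[ℂ] Module.Dual ℂ D := D.subtype.dualMap ∘ₗ Module.Dual.eval ℂ R
  have hev : Function.Injective ev := by
    rw [← LinearMap.ker_eq_bot, LinearMap.ker_eq_bot']
    intro x hx
    exact eq_zero_of_forall_state fun s hs =>
      LinearMap.congr_fun hx (⟨s, Submodule.subset_span ⟨⟨s, hs⟩, rfl⟩⟩ : D)
  have : FiniteDimensional ℂ R := Module.Finite.of_injective ev hev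
  refine Submodule.eq_top_of_finrank_eq (le_antisymm (Submodule.finrank_le _) ?_)
  have h1 := LinearMap.finrank_le_finrank_of_injective hev
  have h2 := LinearMap.finrank_le_finrank_of_injective hρ
  rw [Subspace.dual_finrank_eq] at h1 h2
  exact h1.trans h2

end

/-! ### Maps into and out of quotient systems -/

lemma QuotientSystem.isUCP_mk {S : Type*} [AddCommGroup S] [Module ℂ S] [StarAddMonoid S]
    [StarModule ℂ S] [OperatorSystem S] (K : Kernel S) : IsUCP (QuotientSystem.mk K) :=
  ⟨rfl, fun n X hX _ hε => ⟨X, rfl, add_mem (smul_matUnit_mem n hε.le) hX⟩⟩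

/-- A unital completely positive map that vanishes on a kernel descends to the quotient. -/
lemma QuotientSystem.exists_isUCP_lift {S R : Type*} [AddCommGroup S] [Module ℂ S]
    [StarAddMonoid S] [StarModule ℂ S] [OperatorSystem S] [AddCommGroup R] [Module ℂ R]
    [StarAddMonoid R] [StarModule ℂ R] [OperatorSystem R] (K : Kernel S) {φ : S →ₗ[ℂ] R}
    (hφ : IsUCP φ) (h : ∀ u ∈ K.carrier, φ u = 0) :
    ∃ σ : QuotientSystem K →ₗ[ℂ] R, IsUCP σ ∧ ∀ u, σ (QuotientSystem.mk K u) = φ u := by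
  let σ : QuotientSystem K →ₗ[ℂ] R := K.carrier.liftQ φ h
  have hσ : ∀ u, σ (QuotientSystem.mk K u) = φ u := fun u => rfl
  -- A lift X with ε1 + X positive shows that ε1 + σ(Y) is positive; the Archimedean property of the
  -- codomain removes ε.
  refine ⟨σ, ⟨(hσ unit).trans hφ.1, fun n Y hY => archimedean _ fun ε hε => ?_⟩, hσ⟩
  obtain ⟨X, rfl, hX⟩ := hY ε hε
  convert hφ.2 n _ hX using 1
  ext i j
  by_cases hij : i = j
  · subst hij
    simp [matUnit, hσ, hφ.1]
  · simp [matUnit, hσ, hij]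

end OperatorSystem

/-! ### Edges, generators and the maps `iMap` -/

namespace ContextualityScenario

open OperatorSystem

variable {V : Type*} [Finite V] (G : ContextualityScenario V)

/-- The projection of the direct sum onto `ℓ^∞_e`. -/
def proj (e : G.Edge) : G.DirectSum →ₗ[ℂ] EllInfty e where
  toFun u x := u ⟨e, x⟩
  map_add' _ _ := rfl
  map_smul' _ _ := rfl

lemma isUCP_proj (e : G.Edge) : IsUCP (G.proj e) :=
  ⟨rfl, fun _ _ hX x => hX ⟨e, x⟩⟩

lemma card_ne_zero : (G.edges.card : ℂ) ≠ 0 := by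
  exact_mod_cast G.nonempty.card_pos.ne'

section

variable {G} {H : Type*} [NormedAddCommGroup H] [InnerProductSpace ℂ H]

/-- The linear map `ℓ^∞_e → B(H)` that maps `δ_x^e` to `A_x`. -/
noncomputable def edgeMap (A : V → (H →L[ℂ] H)) (e : G.Edge) : EllInfty e →ₗ[ℂ] (H →L[ℂ] H) :=
  ∑ x : {x : V // x ∈ e.1}, (LinearMap.proj x).smulRight (A x)

lemma edgeMap_apply (A : V → (H →L[ℂ] H)) (e : G.Edge) (v : EllInfty e) :
    edgeMap A e v = ∑ x : {x : V // x ∈ e.1}, v x • A x := by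
  simp [edgeMap, LinearMap.sum_apply]

end

variable [DecidableEq V]

lemma proj_incl_self (e : G.Edge) (v : EllInfty e) : G.proj e (G.incl e v) = v := by
  ext x
  simp [proj, incl_apply]

lemma proj_incl_of_ne {e f : G.Edge} (h : f ≠ e) (v : EllInfty e) :
    G.proj f (G.incl e v) = 0 := by
  ext x
  simp [proj, incl_apply, h]

lemma sum_incl_proj (u : G.DirectSum) : ∑ e, G.incl e (G.proj e u) = u := by
  ext ⟨f, x⟩
  rw [Finset.sum_apply, Finset.sum_eq_single f]
  · simp [proj, incl_apply]
  · intro e _ he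
    simp [incl_apply, he.symm]
  · simp

lemma sum_smul_delta {G : ContextualityScenario V} (e : G.Edge) (v : EllInfty e) :
    ∑ x : {x : V // x ∈ e.1}, v x • delta e x.1 = v := by
  ext y
  rw [Finset.sum_apply, Finset.sum_eq_single y]
  · simp [delta]
  · intro x _ hx
    have : y.1 ≠ x.1 := fun h => hx (Subtype.ext h.symm)
    simp [delta, this]
  · simp

lemma sum_delta {G : ContextualityScenario V} (e : G.Edge) :
    ∑ x ∈ e.1, delta e x = 1 := by
  rw [← sum_smul_delta e 1, ← Finset.sum_coe_sort e.1 (fun x => delta e x)]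
  simp

lemma matOne_delta_mem {G : ContextualityScenario V} (e : G.Edge) (x : V) :
    matOne (delta e x) ∈ cone 1 := by
  intro y
  have h : (0 : ℂ) ≤ delta e x y := by
    unfold delta
    split_ifs <;> simp
  refine .of_dotProduct_mulVec_nonneg ?_ fun v => ?_
  · ext i j
    simp only [Matrix.conjTranspose_apply, Matrix.map_apply, Matrix.of_apply]
    exact (IsSelfAdjoint.of_nonneg h).star_eq
  · simp only [dotProduct, Matrix.mulVec, Finset.univ_unique, Finset.sum_singleton,
      Matrix.map_apply, Matrix.of_apply, Pi.star_apply]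
    rw [mul_left_comm]
    exact mul_nonneg h (star_mul_self_nonneg _)

/-- The factor |E| is what makes the map unital: every probabilistic model pairs to 1 with ι_e(1)
and to |E| with the unit of the direct sum. -/
lemma isUCP_iMap (e : G.Edge) : IsUCP (G.iMap e) := by
  refine ⟨?_, fun n X hX => ?_⟩
  · change (G.edges.card : ℂ) • QuotientSystem.mk G.kernel (G.incl e 1) =
      QuotientSystem.mk G.kernel 1
    rw [← sub_eq_zero, ← map_smul, ← map_sub, QuotientSystem.mk_eq_zero]
    simp only [kernel, Submodule.mem_iInf, LinearMap.mem_ker]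
    rintro ⟨p, hp⟩
    have h1 : ∀ f : G.Edge, G.pairing p (G.incl f 1) = 1 := by
      intro f
      rw [← sum_delta f, map_sum, map_sum,
        Finset.sum_congr rfl fun x hx => G.pairing_incl_delta p f hx]
      exact_mod_cast hp.2 f.1 f.2
    have h2 : G.pairing p 1 = G.edges.card := by
      rw [← G.sum_incl_proj 1, map_sum,
        Finset.sum_congr rfl fun f _ => show G.pairing p (G.incl f (G.proj f 1)) = 1 from h1 f]
      simp
    rw [map_sub, map_smul, h1, h2]
    simp
  · have h1 : X.map (G.incl e) ∈ cone n := by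
      rintro ⟨f, x⟩
      by_cases h : f = e
      · subst h
        convert hX x using 1
        ext i j
        simp [incl_apply]
      · convert Matrix.PosSemidef.zero using 1
        ext i j
        simp [incl_apply, h]
    have := smul_mem (r := G.edges.card) (Nat.cast_nonneg _)
      ((QuotientSystem.isUCP_mk G.kernel).2 n _ h1)
    convert this using 1
    ext i j
    simp [iMap]

/-- Linear maps on `S_G` are determined by their values on the generators. -/
lemma linearMap_ext {M : Type*} [AddCommGroup M] [Module ℂ M] {φ ψ : G.SG →ₗ[ℂ] M}
    (h : ∀ x, φ (G.gen x) = ψ (G.gen x)) : φ = ψ := by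
  have h1 : ∀ (e : G.Edge) (v : EllInfty e), φ (G.iMap e v) = ψ (G.iMap e v) := by
    intro e v
    rw [← sum_smul_delta e v]
    simp only [map_sum, map_smul]
    exact Finset.sum_congr rfl fun x _ => by rw [G.iMap_delta e x.2, h]
  ext y
  obtain ⟨u, rfl⟩ := QuotientSystem.mk_surjective G.kernel y
  rw [← G.sum_incl_proj u]
  simp only [map_sum]
  refine Finset.sum_congr rfl fun e _ => ?_
  have := h1 e (G.proj e u)
  simp only [iMap, LinearMap.smul_apply, map_smul, LinearMap.comp_apply] at this
  exact smul_right_injective _ G.card_ne_zero this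

/-! ### The universal property of `SG` -/

section lift

variable {G}
variable {R : Type*} [AddCommGroup R] [Module ℂ R] [StarAddMonoid R] [StarModule ℂ R]
  [OperatorSystem R] {r : (e : G.Edge) → EllInfty e →ₗ[ℂ] R}

/-- Each s ∘ r_e is a state of ℓ^∞_e, that is, a probability distribution on e; compatibility glues
these into a single function on V. -/
lemma isProbModel_of_isState (hr : ∀ e, IsUCP (r e))
    (hc : ∀ (e f : G.Edge) (x : V), x ∈ e.1 → x ∈ f.1 → r e (delta e x) = r f (delta f x))
    {s : R →ₗ[ℂ] ℂ} (hs : IsState s) :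
    ∃ p : V → ℝ, G.IsProbModel p ∧ ∀ (e : G.Edge) (x : V), x ∈ e.1 →
      s (r e (delta e x)) = p x := by
  let p : V → ℝ := fun x => (s (r (G.someEdge x) (delta (G.someEdge x) x))).re
  have hpos : ∀ (e : G.Edge) (x : V), 0 ≤ s (r e (delta e x)) := fun e x =>
    (hs.comp (hr e)).2 _ (matOne_delta_mem e x)
  have hp : ∀ (e : G.Edge) (x : V), x ∈ e.1 → s (r e (delta e x)) = p x := by
    intro e x hx
    rw [hc e (G.someEdge x) x hx (G.cover x).choose_spec.2]
    exact Complex.ext rfl (Complex.nonneg_iff.1 (hpos _ _)).2.symm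
  have hp0 : ∀ x, 0 ≤ p x := fun x => (Complex.nonneg_iff.1 (hpos _ x)).1
  have hsum : ∀ e ∈ G.edges, ∑ x ∈ e, p x = 1 := by
    intro e he
    have h1 := (hs.comp (hr ⟨e, he⟩)).1
    change (s ∘ₗ r ⟨e, he⟩) 1 = 1 at h1
    rw [← sum_delta, map_sum, Finset.sum_congr rfl fun x hx =>
      show (s ∘ₗ r ⟨e, he⟩) (delta ⟨e, he⟩ x) = p x from hp ⟨e, he⟩ x hx] at h1
    exact_mod_cast h1
  refine ⟨p, ⟨fun x => ⟨hp0 x, ?_⟩, hsum⟩, hp⟩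
  obtain ⟨e, he, hx⟩ := G.cover x
  rw [← hsum e he]
  exact Finset.single_le_sum (f := p) (fun y _ => hp0 y) hx

/-- The universal property of `S_G` with respect to operator systems. -/
theorem exists_isUCP_lift (hr : ∀ e, IsUCP (r e))
    (hc : ∀ (e f : G.Edge) (x : V), x ∈ e.1 → x ∈ f.1 → r e (delta e x) = r f (delta f x)) :
    ∃ σ : G.SG →ₗ[ℂ] R, IsUCP σ ∧ ∀ e, σ ∘ₗ G.iMap e = r e := by
  -- The average over the edges is unital, and its factor |E|⁻¹ cancels the |E| in i_e.
  let L : G.DirectSum →ₗ[ℂ] R := (G.edges.card : ℂ)⁻¹ • ∑ e, r e ∘ₗ G.proj e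
  have hLa : ∀ u, L u = (G.edges.card : ℂ)⁻¹ • ∑ e, r e (G.proj e u) := by
    intro u
    simp [L, LinearMap.sum_apply]
  have hL : IsUCP L := by
    refine ⟨?_, fun n X hX => ?_⟩
    · rw [hLa, Finset.sum_congr rfl fun e _ =>
        show r e (G.proj e unit) = unit from ((hr e).comp (G.isUCP_proj e)).1]
      rw [Finset.sum_const, ← Nat.cast_smul_eq_nsmul ℂ, smul_smul]
      simp [G.nonempty.ne_empty]
    · have h1 := sum_mem Finset.univ (fun e => X.map (r e ∘ₗ G.proj e)) fun e _ =>
        ((hr e).comp (G.isUCP_proj e)).2 n X hX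
      have h2 := smul_mem (r := (G.edges.card : ℝ)⁻¹) (by positivity) h1
      convert h2 using 1
      ext i j
      simp [hLa, Matrix.sum_apply]
  obtain ⟨σ, hσ, hσL⟩ := QuotientSystem.exists_isUCP_lift G.kernel hL (by
    intro u hu
    -- For the model p defined by s, the functional s ∘ L is |E|⁻¹ times the pairing with p, which
    -- vanishes at u.
    refine eq_zero_of_forall_state fun s hs => ?_
    obtain ⟨p, hp, hps⟩ := isProbModel_of_isState hr hc hs
    simp only [kernel, Submodule.mem_iInf, LinearMap.mem_ker] at hu
    rw [hLa, map_smul, map_sum, smul_eq_mul, mul_eq_zero]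
    right
    rw [← hu ⟨p, hp⟩, pairing_apply]
    refine Finset.sum_congr rfl fun e _ => ?_
    rw [← sum_smul_delta e (G.proj e u), map_sum, map_sum]
    refine Finset.sum_congr rfl fun x _ => ?_
    rw [map_smul, map_smul, hps e x.1 x.2, smul_eq_mul, mul_comm]
    rfl)
  refine ⟨σ, hσ, fun e => LinearMap.ext fun v => ?_⟩
  simp only [iMap, LinearMap.comp_apply, LinearMap.smul_apply, map_smul, hσL, hLa]
  rw [smul_smul, mul_inv_cancel₀ G.card_ne_zero, one_smul, Finset.sum_eq_single e]
  · rw [proj_incl_self]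
  · intro f _ hf
    rw [G.proj_incl_of_ne hf, map_zero]
  · simp

end lift

/-! ### Positive operator representations -/

section POR

variable {G}
variable {H : Type*} [NormedAddCommGroup H] [InnerProductSpace ℂ H]

lemma edgeMap_delta (A : V → (H →L[ℂ] H)) (e : G.Edge) {x : V} (hx : x ∈ e.1) :
    edgeMap A e (delta e x) = A x := by
  rw [edgeMap_apply, Finset.sum_eq_single ⟨x, hx⟩]
  · simp [delta]
  · intro y _ hy
    have : y.1 ≠ x := fun h => hy (Subtype.ext h)
    simp [delta, this]
  · simp

variable [CompleteSpace H]

lemma isPOR_of_isUCP {Φ : G.SG →ₗ[ℂ] (H →L[ℂ] H)} (hΦ : IsUCP Φ) :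
    G.IsPOR (fun x => Φ (G.gen x)) := by
  refine ⟨fun x => ?_, fun e he => ?_⟩
  · exact matOne_mem_cone_iff.1
      ((hΦ.comp (G.isUCP_iMap (G.someEdge x))).2 1 _ (matOne_delta_mem (G.someEdge x) x))
  · have h := (hΦ.comp (G.isUCP_iMap ⟨e, he⟩)).1
    change (Φ ∘ₗ G.iMap ⟨e, he⟩) 1 = 1 at h
    rw [← sum_delta, map_sum] at h
    rw [← h]
    exact Finset.sum_congr rfl fun x hx => by
      rw [LinearMap.comp_apply, G.iMap_delta ⟨e, he⟩ hx]

/-- The image of a matrix X over ℓ^∞_e is Σ_x X_x ⊗ A_x, a sum of tensors of positive semidefinite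
matrices with positive operators. -/
lemma isUCP_edgeMap {A : V → (H →L[ℂ] H)} (hA : G.IsPOR A) (e : G.Edge) :
    IsUCP (edgeMap A e) := by
  refine ⟨?_, fun n X hX => ?_⟩
  · change edgeMap A e 1 = 1
    rw [← hA.2 e.1 e.2, ← sum_delta, map_sum]
    exact Finset.sum_congr rfl fun x hx => edgeMap_delta A e hx
  · have := sum_mem Finset.univ
      (fun x : {x : V // x ∈ e.1} => (X.map fun u => u x).map fun z => z • A x)
      fun x _ => map_smul_mem_cone (hX x) (matOne_mem_cone_iff.2 (hA.1 x))
    convert this using 1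
    ext1 i j
    rw [Matrix.map_apply, edgeMap_apply, Matrix.sum_apply]
    rfl

lemma existsUnique_isUCP {A : V → (H →L[ℂ] H)} (hA : G.IsPOR A) :
    ∃! Φ : G.SG →ₗ[ℂ] (H →L[ℂ] H), IsUCP Φ ∧ ∀ x, Φ (G.gen x) = A x := by
  obtain ⟨σ, hσ, hσr⟩ := exists_isUCP_lift (r := edgeMap A) (isUCP_edgeMap hA)
    fun e f x he hf => by rw [edgeMap_delta A e he, edgeMap_delta A f hf]
  have h : ∀ x, σ (G.gen x) = A x := fun x =>
    (LinearMap.congr_fun (hσr (G.someEdge x)) (delta (G.someEdge x) x)).trans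
      (edgeMap_delta A _ (G.cover x).choose_spec.2)
  exact ⟨σ, ⟨hσ, h⟩, fun Φ hΦ => G.linearMap_ext fun x => by rw [hΦ.2, h]⟩

end POR

/-- Uniqueness of `S_G` among the operator systems that classify positive operator
representations. -/
theorem exists_completeOrderIso {R : Type*} [AddCommGroup R] [Module ℂ R] [StarAddMonoid R]
    [StarModule ℂ R] [OperatorSystem R] (r : (e : G.Edge) → EllInfty e →ₗ[ℂ] R)
    (hr : ∀ e, IsUCP (r e))
    (hc : ∀ (e f : G.Edge) (x : V), x ∈ e.1 → x ∈ f.1 → r e (delta e x) = r f (delta f x))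
    (hu : ∀ (H : Type v) [NormedAddCommGroup H] [InnerProductSpace ℂ H] [CompleteSpace H]
      (A : V → (H →L[ℂ] H)), G.IsPOR A → ∃! Ψ : R →ₗ[ℂ] (H →L[ℂ] H),
        IsUCP Ψ ∧ ∀ (e : G.Edge) (x : V), x ∈ e.1 → Ψ (r e (delta e x)) = A x) :
    ∃ θ : R ≃ₗ[ℂ] G.SG, IsUnitalCompleteOrderIso θ ∧
      ∀ e : G.Edge, (θ : R →ₗ[ℂ] G.SG) ∘ₗ r e = G.iMap e := by
  obtain ⟨σ, hσ, hσr⟩ := exists_isUCP_lift hr hc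
  have hσr' : ∀ (e : G.Edge) (v : EllInfty e), σ (G.iMap e v) = r e v :=
    fun e v => LinearMap.congr_fun (hσr e) v
  -- The POR x ↦ φ(a_x) extends to R by hypothesis, and the extension agrees with φ on generators
  -- after composition with σ.
  have hext : ∀ (H : Type v) [NormedAddCommGroup H] [InnerProductSpace ℂ H] [CompleteSpace H]
      (φ : G.SG →ₗ[ℂ] (H →L[ℂ] H)), IsUCP φ →
        ∃ Ψ : R →ₗ[ℂ] (H →L[ℂ] H), IsUCP Ψ ∧ Ψ ∘ₗ σ = φ := by
    intro H _ _ _ φ hφ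
    obtain ⟨Ψ, ⟨hΨ, hΨr⟩, -⟩ := hu H _ (isPOR_of_isUCP hφ)
    refine ⟨Ψ, hΨ, G.linearMap_ext fun x => ?_⟩
    rw [LinearMap.comp_apply, ← hΨr (G.someEdge x) x (G.cover x).choose_spec.2, ← hσr']
    rfl
  have hinj : Function.Injective σ := by
    rw [← LinearMap.ker_eq_bot, LinearMap.ker_eq_bot']
    intro y hy
    refine eq_zero_of_forall_state fun s hs => ?_
    refine eq_of_forall_smul_one_eq.{v} fun H _ _ _ => ?_
    obtain ⟨Ψ, -, hΨ⟩ := hext H _ hs.isUCP_smulRight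
    have h1 := LinearMap.congr_fun hΨ y
    rw [LinearMap.comp_apply, hy, map_zero, LinearMap.smulRight_apply] at h1
    rw [← h1, zero_smul]
  have hfin : FiniteDimensional ℂ G.SG :=
    Module.Finite.of_surjective (QuotientSystem.mk G.kernel)
      (QuotientSystem.mk_surjective G.kernel)
  -- States s, t of R that agree on the range of σ give scalar maps s(·)1 and t(·)1 inducing the
  -- same POR; the uniqueness clause identifies them.
  have hsurj : Function.Surjective σ := by
    rw [← LinearMap.range_eq_top]
    refine hσ.range_eq_top fun s t hs ht hst => LinearMap.ext fun y =>
      eq_of_forall_smul_one_eq.{v} fun H _ _ _ => ?_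
    refine LinearMap.congr_fun (f := s.smulRight (1 : H →L[ℂ] H)) (g := t.smulRight 1) ?_ y
    refine (hu H _ (isPOR_of_isUCP ((hs.comp hσ).isUCP_smulRight (H := H)))).unique
      ⟨hs.isUCP_smulRight, fun e x hx => ?_⟩ ⟨ht.isUCP_smulRight, fun e x hx => ?_⟩
    · rw [← hσr', G.iMap_delta e hx]
      rfl
    · rw [hst, ← hσr', G.iMap_delta e hx]
      rfl
  let θ : G.SG ≃ₗ[ℂ] R := LinearEquiv.ofBijective σ ⟨hinj, hsurj⟩
  have hsymm : ∀ y, σ (θ.symm y) = y := fun y => θ.apply_symm_apply y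
  refine ⟨θ.symm, ⟨⟨?_, fun n X hX => ?_⟩, hσ.2⟩, fun e => ?_⟩
  · exact hinj ((hsymm _).trans hσ.1.symm)
  · have hXσ : (X.map θ.symm).map σ = X := by
      ext i j
      exact hsymm _
    -- Each test map is φ = Ψ ∘ σ, so its value on the preimage of X is Ψ(X), which is positive.
    -- Hermitian symmetry is reflected because σ is injective and preserves the involution.
    refine mem_cone_of_forall_isUCP.{v} ?_ fun H _ _ _ φ hφ => ?_
    · ext1 i j
      refine hinj ?_
      rw [Matrix.conjTranspose_apply, hσ.map_star]
      exact (congrArg star (hsymm _)).trans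
        (((isHermitian_of_mem hX).apply i j).trans (hsymm _).symm)
    · obtain ⟨Ψ, hΨ, rfl⟩ := hext H φ hφ
      have := hΨ.2 n X hX
      rw [← hXσ] at this
      exact this
  · refine LinearMap.ext fun v => ?_
    exact hinj ((hsymm _).trans (hσr' e v).symm)

end ContextualityScenario

theorem mainTheorem6 {V : Type*} [Finite V] [DecidableEq V] (G : ContextualityScenario V)
    (hG : G.Nontrivial) :
    -- unital completely positive maps on `S_G` give positive operator representations
    (∀ (H : Type*) [NormedAddCommGroup H] [InnerProductSpace ℂ H] [CompleteSpace H],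
      (∀ Φ : G.SG →ₗ[ℂ] (H →L[ℂ] H), OperatorSystem.IsUCP Φ → G.IsPOR (fun x => Φ (G.gen x))) ∧
      -- and every positive operator representation arises from exactly one such map
      (∀ A : V → (H →L[ℂ] H), G.IsPOR A →
        ∃! Φ : G.SG →ₗ[ℂ] (H →L[ℂ] H), OperatorSystem.IsUCP Φ ∧ ∀ x, Φ (G.gen x) = A x)) ∧
    -- the canonical maps `i_e : ℓ^∞_e → S_G` are unital and completely positive
    (∀ e : G.Edge, OperatorSystem.IsUCP (G.iMap e)) ∧
    -- uniqueness of `S_G`, together with the maps `i_e`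
    (∀ (R : Type*) [AddCommGroup R] [Module ℂ R] [StarAddMonoid R] [StarModule ℂ R]
      [OperatorSystem R] (r : (e : G.Edge) → ContextualityScenario.EllInfty e →ₗ[ℂ] R),
      (∀ e, OperatorSystem.IsUCP (r e)) →
      -- `r_e(δ_x^e)` depends only on `x`
      (∀ (e f : G.Edge) (x : V), x ∈ e.1 → x ∈ f.1 →
        r e (ContextualityScenario.delta e x) = r f (ContextualityScenario.delta f x)) →
      (∀ (H : Type*) [NormedAddCommGroup H] [InnerProductSpace ℂ H] [CompleteSpace H]
        (A : V → (H →L[ℂ] H)), G.IsPOR A →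
        ∃! Ψ : R →ₗ[ℂ] (H →L[ℂ] H),
          OperatorSystem.IsUCP Ψ ∧ ∀ (e : G.Edge) (x : V), x ∈ e.1 →
            Ψ (r e (ContextualityScenario.delta e x)) = A x) →
      ∃ θ : R ≃ₗ[ℂ] G.SG, OperatorSystem.IsUnitalCompleteOrderIso θ ∧
        ∀ e : G.Edge, (θ : R →ₗ[ℂ] G.SG) ∘ₗ r e = G.iMap e) := by
  refine ⟨fun H _ _ _ => ⟨fun Φ hΦ => ContextualityScenario.isPOR_of_isUCP hΦ,
    fun A hA => ContextualityScenario.existsUnique_isUCP hA⟩, G.isUCP_iMap, ?_⟩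
  intro R _ _ _ _ _ r hr hc hu
  exact G.exists_completeOrderIso r hr hc hu
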